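/- Let $\mathbb S^2\subset\mathbb R^3$ be the unit sphere with its surface measure $\sigma$ (total mass $4\pi$) and the Poisson bracket $\{\psi,\omega\}=\nabla\psi^{\perp}\cdot\nabla\omega$, where $\nabla$ is the Riemannian gradient and $v^{\perp}=p\times v$ for a tangent vector $v$ at $p\in\mathbb S^2$; the bracket is extended complex bilinearly to complex-valued functions. For $\ell\in\mathbb N$, $m\in\mathbb Z$, $|m|\le \ell$, let $Y_{\ell,m}$ be the standard complex spherical harmonics, orthonormal in $L^2(\mathbb S^2,\sigma)$: for $m\ge 0$ and $p=(x,y,z)\in\mathbb S^2$, $$Y_{\ell,m}(p)=(-1)^m\sqrt{\frac{2\ell+1}{4\pi}\frac{(\ell-m)!}{(\ell+m)!}}\,(x+iy)^m\,\frac{1}{2^\ell\,\ell!}\frac{d^{\ell+m}}{dz^{\ell+m}}(z^2-1)^\ell ,\qquad Y_{\ell,-m}=(-1)^m\overline{Y_{\ell,m}} .$$ Let $Y^{\mathbb R}_{\ell,m}$ be the standard real spherical harmonics: $Y^{\mathbb R}_{\ell,0}=Y_{\ell,0}$, $Y^{\mathbb R}_{\ell,m}=(-1)^m\sqrt2\,\mathrm{Re}\,Y_{\ell,m}$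 for $m>0$, and $Y^{\mathbb R}_{\ell,m}=(-1)^m\sqrt2\,\mathrm{Im}\,Y_{\ell,|m|}$ for $m<0$. Let $$C^{\underline\ell\,\underline m}_{\ell m,\ell' m'}=\int_{\mathbb S^2}\{Y_{\ell,m},Y_{\ell',m'}\}\,\overline{Y_{\underline\ell,\underline m}}\,d\sigma$$ be the structure constants of the Poisson bracket with respect to the complex spherical harmonics, that is, the coefficient of $Y_{\underline\ell,\underline m}$ in the expansion of $\{Y_{\ell,m},Y_{\ell',m'}\}$ in this orthonormal basis, and let $R^{\underline\ell\,\underline m}_{\ell m,\ell' m'}$ be the structure constants defined in the same way with $Y^{\mathbb R}$ in place of $Y$. Then there exists a constant $C>0$ such that, for all integers $\ell,\ell',\underline\ell\ge 1$ satisfying the triangle inequalities $\ell\le\ell'+\underline\ell$, $\ell'\le\ell+\underline\ell$, $\underline\ell\le\ell+\ell'$, and all integers $m,m',\underline m$ with $|m|\le\ell$, $|m'|\le\ell'$, $|\underline m|\le\underline\ell$, $$\bigl|C^{\underline\ell\,\underline m}_{\ell m,\ell' m'}\bigr|\le C\min\{\ell\ell',\ell\underline\ell,\ell'\underline\ell\}\qquad\text{and}\qquad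 \bigl|R^{\underline\ell\,\underline m}_{\ell m,\ell' m'}\bigr|\le C\min\{\ell\ell',\ell\underline\ell,\ell'\underline\ell\}.$$ -/

import Mathlib

open MeasureTheory

/-- The unit sphere of Euclidean three-space. -/
abbrev UnitSphere2 : Type := Metric.sphere (0 : EuclideanSpace ℝ (Fin 3)) 1

/-- The extension of `f` from the sphere to `ℝ³ ∖ {0}` that is constant along rays
(with value `0` at the origin). -/
noncomputable def radialExtension {𝕜 : Type*} [RCLike 𝕜] (f : UnitSphere2 → 𝕜)
    (x : EuclideanSpace ℝ (Fin 3)) : 𝕜 :=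
  open Classical in
  if h : x ≠ 0 then
    f ⟨‖x‖⁻¹ • x, by
      rw [mem_sphere_zero_iff_norm, norm_smul, norm_inv, norm_norm,
        inv_mul_cancel₀ (norm_ne_zero_iff.mpr h)]⟩
  else 0

/-- The Riemannian gradient of `f` on the round sphere at `p`, as a vector of `𝕜³`: since the
radial extension is constant along rays, its Euclidean gradient at `p` is tangent to the sphere
and is the gradient of `f`. -/
noncomputable def sphereGradient {𝕜 : Type*} [RCLike 𝕜] (f : UnitSphere2 → 𝕜) (p : UnitSphere2) :
    Fin 3 → 𝕜 :=
  fun i => fderiv ℝ (radialExtension f) (p : EuclideanSpace ℝ (Fin 3))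
    (EuclideanSpace.single i (1 : ℝ))

/-- The Poisson bracket `{ψ, ω} = ∇ψ^⊥ · ∇ω` on the sphere, where `v^⊥ = p × v` is the rotation
of a tangent vector `v` at `p` by a right angle (extended complex bilinearly if `𝕜 = ℂ`). -/
noncomputable def spherePoisson {𝕜 : Type*} [RCLike 𝕜] (ψ ω : UnitSphere2 → 𝕜)
    (p : UnitSphere2) : 𝕜 :=
  dotProduct
    (crossProduct (fun i => (((p : EuclideanSpace ℝ (Fin 3)) i : ℝ) : 𝕜)) (sphereGradient ψ p))
    (sphereGradient ω p)

/-- The standard complex spherical harmonic of degree `ℓ` and order `m ≥ 0`,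
`(-1)^m √((2ℓ+1)/(4π) · (ℓ-m)!/(ℓ+m)!) (sin θ)^m e^{imφ} (d/dz)^{ℓ+m} (z²-1)^ℓ / (2^ℓ ℓ!)`
at the point `(x, y, z) = (sin θ cos φ, sin θ sin φ, cos θ)`;
here `(sin θ)^m e^{imφ} = (x + iy)^m`. -/
noncomputable def sphericalHarmonicNonneg (ℓ m : ℕ) (p : UnitSphere2) : ℂ :=
  let q : EuclideanSpace ℝ (Fin 3) := p
  (-1 : ℂ) ^ m *
    ((Real.sqrt ((2 * (ℓ : ℝ) + 1) / (4 * Real.pi) *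
      ((Nat.factorial (ℓ - m) : ℝ) / (Nat.factorial (ℓ + m) : ℝ))) : ℝ) : ℂ) *
    (((q 0 : ℝ) : ℂ) + ((q 1 : ℝ) : ℂ) * Complex.I) ^ m *
    (((Polynomial.derivative^[ℓ + m] ((Polynomial.X ^ 2 - 1 : Polynomial ℝ) ^ ℓ)).eval (q 2) /
      (2 ^ ℓ * (Nat.factorial ℓ : ℝ)) : ℝ) : ℂ)

/-- The standard complex spherical harmonics `Y_{ℓ,m}`, `|m| ≤ ℓ` (orthonormal for the surface
measure, Condon-Shortley phase, `Y_{ℓ,-m} = (-1)^m conj Y_{ℓ,m}`). -/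
noncomputable def sphericalHarmonic (ℓ : ℕ) (m : ℤ) (p : UnitSphere2) : ℂ :=
  if 0 ≤ m then sphericalHarmonicNonneg ℓ m.natAbs p
  else (-1 : ℂ) ^ m.natAbs * (starRingEnd ℂ) (sphericalHarmonicNonneg ℓ m.natAbs p)

/-- The standard real spherical harmonics: `Y_{ℓ,0}` for `m = 0`, `(-1)^m √2 Re Y_{ℓ,m}` for
`m > 0` and `(-1)^m √2 Im Y_{ℓ,|m|}` for `m < 0`. -/
noncomputable def realSphericalHarmonic (ℓ : ℕ) (m : ℤ) (p : UnitSphere2) : ℝ :=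
  if m = 0 then (sphericalHarmonic ℓ 0 p).re
  else if 0 < m then (-1 : ℝ) ^ m.natAbs * Real.sqrt 2 * (sphericalHarmonic ℓ m p).re
  else (-1 : ℝ) ^ m.natAbs * Real.sqrt 2 * (sphericalHarmonic ℓ (-m) p).im

/-- The structure constant of the Poisson bracket with respect to an orthonormal family `Y`:
the coefficient of `Y L M` in the expansion of `{Y ℓ m, Y ℓ' m'}`, that is, the `L²(S²)` inner
product of `{Y ℓ m, Y ℓ' m'}` with `Y L M` for the surface measure (total mass `4π`). -/
noncomputable def poissonStructureConstant {𝕜 : Type*} [RCLike 𝕜]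
    (Y : ℕ → ℤ → UnitSphere2 → 𝕜) (ℓ : ℕ) (m : ℤ) (ℓ' : ℕ) (m' : ℤ) (L : ℕ) (M : ℤ) : 𝕜 :=
  ∫ p : UnitSphere2, spherePoisson (Y ℓ m) (Y ℓ' m') p * (starRingEnd 𝕜) (Y L M p)
    ∂((volume : Measure (EuclideanSpace ℝ (Fin 3))).toSphere)

/-! For Laplace eigenfunctions F, G, H on the sphere of degrees a, b, c put T = ∫ {F, G} H. The
bracket is a derivation with vanishing integral, so T is invariant under cyclic permutations of F,
G, H. Hence H may be given the largest degree, and the claim becomes |T| ≤ const · ab for functions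
of bounded norm.

By the Funk–Hecke formula, eigenfunctions of degree ℓ are reproduced by the zonal kernel with
profile (2ℓ+1)/(4π) · P_ℓ. Reproducing F and G gives T = ∫∫ F(q) G(q') B(q, q'), where B(q, q')
pairs H with the bracket of the two zonal kernels with poles q and q'. Cauchy–Schwarz bounds T² by
‖F‖²‖G‖² times the Hilbert–Schmidt norm ∫∫ B². That norm is computed exactly. If f, g are the two
profiles, integrating out both poles leaves the zonal kernel -((1-t²) f' g')' at t = p · r, and
Funk–Hecke followed by an integration by parts yields T² ≤ (2a+1)(2b+1)/(8π) · ∫ (1-t²) P_a' P_b'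
P_c' dt · ‖F‖²‖G‖²‖H‖² (`sphereIntegral_polyBracket_mul_sq_le_integralPoly`).

With t = cos θ the integral carries the weight sin³θ dθ. The Bernstein bound sin^{3/2}θ |P_ℓ'(cos
θ)| ≲ √ℓ, obtained from the monotonicity of a Sonin function, absorbs this weight into P_b' P_c',
and ∫ |P_a'(cos θ)| dθ ≲ a. The integral is thus ≲ a√(bc). If a ≤ b ≤ c ≤ a + b then c ≤ 2b, so it
is ≲ ab and T² ≲ (ab)².

The calculus on the sphere is done with polynomials in x, y, z and infinitesimal rotations. The
spherical harmonics enter only through their real and imaginary parts, which are polynomial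
eigenfunctions of norm at most 1. -/

/-! ### Legendre polynomials -/

section Legendre

open Polynomial

/-- The Legendre polynomial of degree `ℓ`, by Rodrigues' formula. -/
noncomputable def legendreP (ℓ : ℕ) : ℝ[X] :=
  C ((2 ^ ℓ * (Nat.factorial ℓ : ℝ))⁻¹) * derivative^[ℓ] ((X ^ 2 - 1) ^ ℓ)

theorem iterate_derivative_legendreP (ℓ m : ℕ) :
    derivative^[m] (legendreP ℓ) =
      C ((2 ^ ℓ * (Nat.factorial ℓ : ℝ))⁻¹) * derivative^[ℓ + m] ((X ^ 2 - 1) ^ ℓ) := by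
  rw [legendreP, iterate_derivative_C_mul, ← Function.iterate_add_apply, add_comm]

/-- The function u = (t²-1)^ℓ solves (t²-1)u' = 2ℓtu. One differentiation of this is the case k = 0,
and each further differentiation raises k by one. -/
theorem iterate_derivative_X_sq_sub_one_pow (ℓ k : ℕ) :
    (X ^ 2 - 1) * derivative^[k + 2] ((X ^ 2 - 1 : ℝ[X]) ^ ℓ) +
      C (2 * ((k : ℝ) + 1 - ℓ)) * X * derivative^[k + 1] ((X ^ 2 - 1) ^ ℓ) +
      C (((k : ℝ) + 1) * (k - 2 * ℓ)) * derivative^[k] ((X ^ 2 - 1) ^ ℓ) = 0 := by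
  induction k with
  | zero =>
    have h : (X ^ 2 - 1) * derivative ((X ^ 2 - 1 : ℝ[X]) ^ ℓ) =
        C (2 * (ℓ : ℝ)) * X * (X ^ 2 - 1) ^ ℓ := by
      rcases ℓ with _ | n
      · simp
      · simp [derivative_pow]
        ring
    have h' := congrArg derivative h
    simp only [derivative_mul, derivative_sub, derivative_X_pow, derivative_one, derivative_C,
      derivative_X] at h'
    simp only [Function.iterate_succ, Function.iterate_zero, Function.comp, id]
    push_cast at h' ⊢
    simp only [map_mul, map_sub, map_add, map_one, map_zero, map_ofNat, map_natCast] at h' ⊢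
    linear_combination h'
  | succ k ih =>
    have h' := congrArg derivative ih
    simp only [derivative_mul, derivative_add, derivative_sub, derivative_X_pow, derivative_one,
      derivative_C, derivative_X, derivative_zero, ← Function.iterate_succ_apply'] at h'
    push_cast at h' ⊢
    simp only [map_mul, map_sub, map_add, map_one, map_ofNat, map_natCast] at h' ⊢
    rw [show (k + 1 + 2) = (k + 2).succ from rfl, show k + 1 + 1 = (k+1).succ from rfl]
    linear_combination h'

/-- The differential equation of the derivatives of Legendre polynomials. -/
theorem legendreP_ode (ℓ m : ℕ) :
    (1 - X ^ 2) * derivative^[m + 2] (legendreP ℓ) =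
      C (2 * ((m : ℝ) + 1)) * X * derivative^[m + 1] (legendreP ℓ) -
      C ((ℓ : ℝ) * (ℓ + 1) - m * (m + 1)) * derivative^[m] (legendreP ℓ) := by
  have h := iterate_derivative_X_sq_sub_one_pow ℓ (ℓ + m)
  simp only [iterate_derivative_legendreP, ← add_assoc]
  push_cast at h
  simp only [map_mul, map_sub, map_add, map_one, map_ofNat, map_natCast] at h ⊢
  linear_combination (-C ((2 ^ ℓ * (Nat.factorial ℓ : ℝ))⁻¹)) * h

theorem eval_legendreP_ode (ℓ m : ℕ) (t : ℝ) :
    (1 - t ^ 2) * (derivative^[m + 2] (legendreP ℓ)).eval t =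
      2 * (m + 1) * t * (derivative^[m + 1] (legendreP ℓ)).eval t -
      ((ℓ : ℝ) * (ℓ + 1) - m * (m + 1)) * (derivative^[m] (legendreP ℓ)).eval t := by
  simpa using congrArg (eval t) (legendreP_ode ℓ m)

/-! ### Endpoint values, degree and leading coefficient of Legendre polynomials. -/

theorem eval_iterate_derivative_X_sub_C_pow_mul (a : ℝ) (n : ℕ) (g : ℝ[X]) :
    (derivative^[n] ((X - C a) ^ n * g)).eval a = n.factorial * g.eval a := by
  induction n generalizing g with
  | zero => simp
  | succ n ih =>
    have : derivative ((X - C a) ^ (n + 1) * g) =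
        (X - C a) ^ n * (C ((n : ℝ) + 1) * g + (X - C a) * derivative g) := by
      simp [derivative_mul, derivative_X_sub_C_pow]
      ring
    rw [Function.iterate_succ_apply, this, ih]
    simp [Nat.factorial_succ]
    ring

theorem legendreP_eval_one (ℓ : ℕ) : (legendreP ℓ).eval 1 = 1 := by
  have h : (X ^ 2 - 1 : ℝ[X]) ^ ℓ = (X - C 1) ^ ℓ * (X + 1) ^ ℓ := by
    rw [← mul_pow]; congr 1; simp; ring
  have h0 : (Nat.factorial ℓ : ℝ) ≠ 0 := by positivity
  rw [legendreP, h, eval_mul, eval_iterate_derivative_X_sub_C_pow_mul]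
  simp
  norm_num
  field_simp

theorem legendreP_eval_neg_one_sq (ℓ : ℕ) : (legendreP ℓ).eval (-1) ^ 2 = 1 := by
  have h : (X ^ 2 - 1 : ℝ[X]) ^ ℓ = (X - C (-1)) ^ ℓ * (X - 1) ^ ℓ := by
    rw [← mul_pow]; congr 1; simp; ring
  have h0 : (Nat.factorial ℓ : ℝ) ≠ 0 := by positivity
  rw [legendreP, h, eval_mul, eval_iterate_derivative_X_sub_C_pow_mul]
  simp
  norm_num
  rw [neg_pow 2]
  field_simp
  exact neg_one_pow_eq_or ℝ ℓ

theorem natDegree_X_sq_sub_one_pow (ℓ : ℕ) : ((X ^ 2 - 1 : ℝ[X]) ^ ℓ).natDegree = 2 * ℓ := by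
  rw [natDegree_pow, show (X ^ 2 - 1 : ℝ[X]) = X ^ 2 - C 1 by simp, natDegree_X_pow_sub_C, mul_comm]

theorem natDegree_legendreP_le (ℓ : ℕ) : (legendreP ℓ).natDegree ≤ ℓ := by
  refine (natDegree_C_mul_le _ _).trans ((natDegree_iterate_derivative _ _).trans ?_)
  rw [natDegree_X_sq_sub_one_pow]
  omega

theorem coeff_legendreP_self_ne_zero (ℓ : ℕ) : (legendreP ℓ).coeff ℓ ≠ 0 := by
  have h0 : (Nat.factorial ℓ : ℝ) ≠ 0 := by positivity
  have hm : ((X ^ 2 - 1 : ℝ[X]) ^ ℓ).Monic := by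
    apply Monic.pow
    rw [show (X ^ 2 - 1 : ℝ[X]) = X ^ 2 - C 1 by simp]
    exact monic_X_pow_sub_C _ two_ne_zero
  have hc : ((X ^ 2 - 1 : ℝ[X]) ^ ℓ).coeff (ℓ + ℓ) = 1 := by
    rw [← two_mul, ← natDegree_X_sq_sub_one_pow]
    exact hm
  rw [legendreP, coeff_C_mul, coeff_iterate_derivative, hc]
  have : ((ℓ + ℓ).descFactorial ℓ : ℝ) ≠ 0 := by
    have := Nat.descFactorial_pos (n := ℓ + ℓ) (k := ℓ)
    exact_mod_cast (this.2 (by omega)).ne'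
  simp [this, h0]

/-- The Legendre operator `f ↦ ((1 - t²) f')'`. -/
noncomputable def legendreOp : ℝ[X] →ₗ[ℝ] ℝ[X] :=
  derivative ∘ₗ (LinearMap.mulLeft ℝ (1 - X ^ 2 : ℝ[X])) ∘ₗ derivative

theorem legendreOp_apply (f : ℝ[X]) :
    legendreOp f = derivative ((1 - X ^ 2) * derivative f) := rfl

theorem legendreOp_legendreP (ℓ : ℕ) :
    legendreOp (legendreP ℓ) = C (-((ℓ : ℝ) * (ℓ + 1))) * legendreP ℓ := by
  have h := legendreP_ode ℓ 0
  simp only [zero_add, Function.iterate_succ, Function.iterate_zero, Function.comp, id] at h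
  rw [legendreOp_apply, derivative_mul, h]
  simp [map_ofNat]
  ring

/-- In the monomial basis the operator is triangular, with diagonal entries -n(n+1) and the
remaining term two degrees lower. This permits solving for leading coefficients one degree at a
time. -/
theorem coeff_legendreOp (f : ℝ[X]) (n : ℕ) :
    (legendreOp f).coeff n =
      ((n : ℝ) + 2) * (n + 1) * f.coeff (n + 2) - n * (n + 1) * f.coeff n := by
  rw [legendreOp_apply, sub_mul, one_mul, derivative_sub, coeff_sub, coeff_derivative,
    coeff_derivative, coeff_derivative, coeff_X_pow_mul']
  rcases n with _ | n
  · simp; ring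
  · simp [coeff_derivative]
    ring

/-- Modulo the range of the Legendre operator minus its eigenvalue, every polynomial is a multiple
of the Legendre polynomial; the multiple is zero in lower degree. -/
theorem exists_eq_legendreOp_add (ℓ n : ℕ) (f : ℝ[X]) (hf : f.degree < n) :
    ∃ (g : ℝ[X]) (c : ℝ), f = legendreOp g + C ((ℓ : ℝ) * (ℓ + 1)) * g + C c * legendreP ℓ ∧
      (n ≤ ℓ → c = 0) := by
  induction n generalizing f with
  | zero =>
    refine ⟨0, 0, ?_, fun _ => rfl⟩
    have : f = 0 := by simpa [degree_lt_iff_coeff_zero, Polynomial.ext_iff] using hf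
    simp [this]
  | succ n ih =>
    rw [degree_lt_iff_coeff_zero] at hf
    by_cases hn : n = ℓ
    · subst hn
      -- Degree ℓ is resonant: the diagonal entry vanishes, so the leading term is removed by a
      -- multiple of the Legendre polynomial instead.
      obtain ⟨g, c, h1, -⟩ := ih (f - C (f.coeff n / (legendreP n).coeff n) * legendreP n) (by
        rw [degree_lt_iff_coeff_zero]
        intro k hk
        rcases hk.eq_or_lt with rfl | hk
        · simp [coeff_legendreP_self_ne_zero]
        · rw [coeff_sub, coeff_C_mul, hf k hk,
            coeff_eq_zero_of_natDegree_lt ((natDegree_legendreP_le n).trans_lt hk)]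
          simp)
      refine ⟨g, c + f.coeff n / (legendreP n).coeff n, ?_, by omega⟩
      rw [map_add]
      linear_combination h1
    · have hne : (ℓ : ℝ) * (ℓ + 1) - n * (n + 1) ≠ 0 := by
        have h : (ℓ : ℝ) * (ℓ + 1) - n * (n + 1) = (ℓ - n) * (ℓ + n + 1) := by ring
        rw [h]
        refine mul_ne_zero ?_ (by positivity)
        rw [sub_ne_zero]
        exact_mod_cast Ne.symm hn
      set a : ℝ := f.coeff n / ((ℓ : ℝ) * (ℓ + 1) - n * (n + 1)) with ha
      have haa : a * ((ℓ : ℝ) * (ℓ + 1) - n * (n + 1)) = f.coeff n := by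
        rw [ha]; field_simp
      obtain ⟨g, c, h1, h2⟩ :=
          ih (f - (legendreOp (C a * X ^ n) + C ((ℓ : ℝ) * (ℓ + 1)) * (C a * X ^ n))) (by
        rw [degree_lt_iff_coeff_zero]
        intro k hk
        rw [coeff_sub, coeff_add, coeff_legendreOp]
        simp only [coeff_C_mul, coeff_X_pow]
        rcases hk.eq_or_lt with rfl | hk
        · simp
          linarith
        · rw [hf k hk]
          simp [hk.ne', show k + 2 ≠ n by omega])
      refine ⟨g + C a * X ^ n, c, ?_, fun h => h2 (by omega)⟩
      rw [map_add]
      linear_combination h1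

/-- The point is that one constant c, depending only on f, serves every functional that kills the
range of the shifted operator. Any two such functionals are therefore proportional; integration
against the Legendre polynomial on [-1, 1] and zonal pairings on the sphere are compared in this
way. -/
theorem exists_legendre_multiple (ℓ : ℕ) (f : ℝ[X]) :
    ∃ c : ℝ, (∀ Λ : ℝ[X] →ₗ[ℝ] ℝ, (∀ g, Λ (legendreOp g + C ((ℓ : ℝ) * (ℓ + 1)) * g) = 0) →
      Λ f = c * Λ (legendreP ℓ)) ∧ (f.degree < ℓ → c = 0) := by
  obtain ⟨n, hn, hn'⟩ : ∃ n : ℕ, f.degree < n ∧ (f.degree < ℓ → n ≤ ℓ) := by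
    by_cases hd : f.degree < ℓ
    · exact ⟨ℓ, hd, fun _ => le_rfl⟩
    · exact ⟨f.natDegree + 1, degree_le_natDegree.trans_lt (by exact_mod_cast Nat.lt_succ_self _),
        fun h => absurd h hd⟩
  obtain ⟨g, c, h1, h2⟩ := exists_eq_legendreOp_add ℓ n f hn
  refine ⟨c, fun Λ h' => ?_, fun h => h2 (hn' h)⟩
  rw [h1, map_add, h', zero_add, ← smul_eq_C_mul, map_smul, smul_eq_mul]

/-! ### Integrals over `[-1, 1]` -/

theorem intervalIntegrable_eval (f : ℝ[X]) (a b : ℝ) :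
    IntervalIntegrable (fun t => f.eval t) volume a b :=
  f.continuous.intervalIntegrable _ _

theorem integral_eval_derivative (f : ℝ[X]) (a b : ℝ) :
    ∫ t in a..b, (derivative f).eval t = f.eval b - f.eval a :=
  intervalIntegral.integral_eq_sub_of_hasDerivAt (fun t _ => f.hasDerivAt t)
    (intervalIntegrable_eval _ _ _)

/-- Integration over `[-1, 1]`, as a functional on polynomials. -/
noncomputable def integralPoly : ℝ[X] →ₗ[ℝ] ℝ where
  toFun f := ∫ t in (-1 : ℝ)..1, f.eval t
  map_add' f g := by
    simp only [eval_add]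
    exact intervalIntegral.integral_add (intervalIntegrable_eval _ _ _)
      (intervalIntegrable_eval _ _ _)
  map_smul' c f := by simp

theorem integralPoly_apply (f : ℝ[X]) : integralPoly f = ∫ t in (-1 : ℝ)..1, f.eval t := rfl

theorem integralPoly_derivative (f : ℝ[X]) :
    integralPoly (derivative f) = f.eval 1 - f.eval (-1) :=
  integral_eval_derivative f _ _

theorem integralPoly_C_mul (c : ℝ) (f : ℝ[X]) : integralPoly (C c * f) = c * integralPoly f := by
  rw [← smul_eq_C_mul, map_smul, smul_eq_mul]

/-- Integration by parts; the factor 1-t² removes the boundary terms. The right-hand side is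
symmetric in f and g, which gives self-adjointness. -/
theorem integralPoly_legendreOp_mul (f g : ℝ[X]) :
    integralPoly (legendreOp f * g) =
      -integralPoly ((1 - X ^ 2) * derivative f * derivative g) := by
  have h := integralPoly_derivative ((1 - X ^ 2) * derivative f * g)
  rw [derivative_mul, ← legendreOp_apply, map_add] at h
  simp at h
  linarith

theorem integralPoly_legendreOp_add (ℓ : ℕ) (g : ℝ[X]) :
    integralPoly ((legendreOp g + C ((ℓ : ℝ) * (ℓ + 1)) * g) * legendreP ℓ) = 0 := by
  have h1 := integralPoly_legendreOp_mul g (legendreP ℓ)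
  have h2 := integralPoly_legendreOp_mul (legendreP ℓ) g
  rw [legendreOp_legendreP, mul_assoc, integralPoly_C_mul] at h2
  rw [add_mul, map_add, mul_assoc, integralPoly_C_mul, h1, mul_comm g,
    mul_right_comm _ (derivative g)]
  linarith

theorem integralPoly_mul_legendreP (ℓ : ℕ) (f : ℝ[X]) :
    ∃ c : ℝ, (∀ Λ : ℝ[X] →ₗ[ℝ] ℝ, (∀ g, Λ (legendreOp g + C ((ℓ : ℝ) * (ℓ + 1)) * g) = 0) →
      Λ f = c * Λ (legendreP ℓ)) ∧
      integralPoly (f * legendreP ℓ) = c * integralPoly (legendreP ℓ * legendreP ℓ) ∧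
      (f.degree < ℓ → c = 0) := by
  obtain ⟨c, h1, h2⟩ := exists_legendre_multiple ℓ f
  exact ⟨c, h1, h1 (integralPoly ∘ₗ LinearMap.mulRight ℝ (legendreP ℓ))
    (fun g => integralPoly_legendreOp_add ℓ g), h2⟩

theorem integralPoly_mul_legendreP_of_degree_lt {ℓ : ℕ} {f : ℝ[X]} (hf : f.degree < ℓ) :
    integralPoly (f * legendreP ℓ) = 0 := by
  obtain ⟨c, -, h, hc⟩ := integralPoly_mul_legendreP ℓ f
  rw [h, hc hf, zero_mul]

theorem integralPoly_legendreP_sq (ℓ : ℕ) :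
    integralPoly (legendreP ℓ * legendreP ℓ) = 2 / (2 * ℓ + 1) := by
  -- The primitive (t+1)P² vanishes at -1 and equals 2 at 1. In its derivative, (t+1)P' differs from
  -- ℓP by a polynomial of degree below ℓ, which is orthogonal to P.
  have h := integralPoly_derivative (X * (legendreP ℓ * legendreP ℓ) + legendreP ℓ * legendreP ℓ)
  have e : derivative (X * (legendreP ℓ * legendreP ℓ) + legendreP ℓ * legendreP ℓ) =
      legendreP ℓ * legendreP ℓ + C (2 * (ℓ : ℝ)) * (legendreP ℓ * legendreP ℓ) +
      C 2 * ((X * derivative (legendreP ℓ) - C (ℓ : ℝ) * legendreP ℓ +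
        derivative (legendreP ℓ)) * legendreP ℓ) := by
    simp [derivative_mul, map_ofNat]
    ring
  have hd : (X * derivative (legendreP ℓ) - C (ℓ : ℝ) * legendreP ℓ +
        derivative (legendreP ℓ)).degree < (ℓ : WithBot ℕ) := by
    rw [degree_lt_iff_coeff_zero]
    intro k hk
    have hz : ∀ j, ℓ < j → (legendreP ℓ).coeff j = 0 := fun j hj =>
      coeff_eq_zero_of_natDegree_lt ((natDegree_legendreP_le ℓ).trans_lt hj)
    rw [coeff_add, coeff_sub, coeff_C_mul]
    rcases k with _ | k
    · have : ℓ = 0 := by omega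
      subst this
      simp [coeff_derivative, hz]
    · simp only [coeff_X_mul, coeff_derivative, hz (k + 1 + 1) (by omega)]
      rcases hk.eq_or_lt with h | h
      · rw [h]; push_cast; ring
      · rw [hz _ h]; ring
  rw [e, map_add, map_add, integralPoly_C_mul, integralPoly_C_mul,
    integralPoly_mul_legendreP_of_degree_lt hd] at h
  simp [legendreP_eval_one] at h
  rw [eq_div_iff (by positivity)]
  linarith

theorem integralPoly_mono {f g : ℝ[X]} (h : ∀ t ∈ Set.Icc (-1 : ℝ) 1, f.eval t ≤ g.eval t) :
    integralPoly f ≤ integralPoly g :=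
  intervalIntegral.integral_mono_on (by norm_num) (intervalIntegrable_eval _ _ _)
    (intervalIntegrable_eval _ _ _) h

/-- The weighted square norms of the derivatives of Legendre polynomials. -/
theorem integralPoly_iterate_derivative_legendreP_sq (ℓ m : ℕ) (hm : m ≤ ℓ) :
    integralPoly ((1 - X ^ 2) ^ m * derivative^[m] (legendreP ℓ) ^ 2) =
      2 / (2 * ℓ + 1) * ((ℓ + m).factorial / (ℓ - m).factorial) := by
  induction m with
  | zero =>
    have : ((ℓ.factorial : ℝ)) ≠ 0 := by positivity
    simp [sq, integralPoly_legendreP_sq, this]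
  | succ m ih =>
    have ih := ih (by omega)
    -- The boundary terms vanish because of the weight, and the differential equation turns the
    -- integrand into the difference of consecutive norms. Their ratio is ℓ(ℓ+1) - m(m+1) =
    -- (ℓ-m)(ℓ+m+1).
    have h := integralPoly_derivative
      ((1 - X ^ 2) ^ (m + 1) * (derivative^[m + 1] (legendreP ℓ) * derivative^[m] (legendreP ℓ)))
    have e : derivative ((1 - X ^ 2) ^ (m + 1) *
        (derivative^[m + 1] (legendreP ℓ) * derivative^[m] (legendreP ℓ))) =
        (1 - X ^ 2) ^ (m + 1) * derivative^[m + 1] (legendreP ℓ) ^ 2 -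
        C ((ℓ : ℝ) * (ℓ + 1) - m * (m + 1)) *
          ((1 - X ^ 2) ^ m * derivative^[m] (legendreP ℓ) ^ 2) := by
      have ode := legendreP_ode ℓ m
      simp only [derivative_mul, ← Function.iterate_succ_apply', derivative_pow, derivative_sub,
        derivative_one, derivative_X, Nat.succ_eq_add_one, add_assoc]
      simp only [map_mul, map_sub, map_add, map_one, map_ofNat, map_natCast] at ode ⊢
      push_cast
      simp [-Function.iterate_succ]
      linear_combination ((1 - X ^ 2) ^ m * derivative^[m] (legendreP ℓ)) * ode
    rw [e, map_sub, integralPoly_C_mul, ih] at h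
    simp [-Function.iterate_succ] at h
    have h1 : ((ℓ - m).factorial : ℝ) = (ℓ - m) * (ℓ - (m + 1)).factorial := by
      rw [show ℓ - m = (ℓ - (m + 1)) + 1 by omega, Nat.factorial_succ]
      push_cast [Nat.cast_sub hm]
      ring
    have h2 : ((ℓ + (m + 1)).factorial : ℝ) = (ℓ + m + 1) * (ℓ + m).factorial := by
      rw [← add_assoc, Nat.factorial_succ]; push_cast; ring
    have h3 : (ℓ : ℝ) - m ≠ 0 := by
      rw [sub_ne_zero]; exact_mod_cast (by omega : ℓ ≠ m)
    have h4 : (((ℓ - (m + 1)).factorial : ℝ)) ≠ 0 := by positivity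
    rw [sub_eq_zero.mp h, h1, h2]
    field_simp
    ring

end Legendre

/-! ### Pointwise and integral bounds for derivatives of Legendre polynomials -/

section LegendreBounds

open Polynomial

/-- A derivative with the sign of t makes f decrease on [-1, 0] and increase on [0, 1]. Energies of
Legendre derivatives use the upper bound, Sonin's function the lower one. -/
theorem le_max_of_hasDerivAt_eq_mul {f φ : ℝ → ℝ} (hc : ContinuousOn f (Set.Icc (-1) 1))
    (hf : ∀ t ∈ Set.Ioo (-1 : ℝ) 1, HasDerivAt f (t * φ t) t)
    (hφ : ∀ t ∈ Set.Ioo (-1 : ℝ) 1, 0 ≤ φ t) {t : ℝ} (ht : t ∈ Set.Icc (-1 : ℝ) 1) :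
    f 0 ≤ f t ∧ f t ≤ max (f 1) (f (-1)) := by
  have hmono : MonotoneOn f (Set.Icc 0 1) := by
    refine monotoneOn_of_deriv_nonneg (convex_Icc _ _)
      (hc.mono (Set.Icc_subset_Icc (by norm_num) le_rfl)) ?_ ?_
    all_goals
      intro x hx
      rw [interior_Icc] at hx
      have hx' : x ∈ Set.Ioo (-1 : ℝ) 1 := ⟨by linarith [hx.1], hx.2⟩
    · exact (hf x hx').differentiableAt.differentiableWithinAt
    · rw [(hf x hx').deriv]
      exact mul_nonneg hx.1.le (hφ x hx')
  have hanti : AntitoneOn f (Set.Icc (-1) 0) := by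
    refine antitoneOn_of_deriv_nonpos (convex_Icc _ _)
      (hc.mono (Set.Icc_subset_Icc le_rfl (by norm_num))) ?_ ?_
    all_goals
      intro x hx
      rw [interior_Icc] at hx
      have hx' : x ∈ Set.Ioo (-1 : ℝ) 1 := ⟨hx.1, by linarith [hx.2]⟩
    · exact (hf x hx').differentiableAt.differentiableWithinAt
    · rw [(hf x hx').deriv]
      exact mul_nonpos_of_nonpos_of_nonneg hx.2.le (hφ x hx')
  rcases le_total 0 t with h | h
  · exact ⟨hmono ⟨le_rfl, by norm_num⟩ ⟨h, ht.2⟩ h,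
      le_max_of_le_left (hmono ⟨h, ht.2⟩ ⟨by norm_num, le_rfl⟩ ht.2)⟩
  · exact ⟨hanti ⟨ht.1, h⟩ ⟨by norm_num, le_rfl⟩ h,
      le_max_of_le_right (hanti ⟨le_rfl, by norm_num⟩ ⟨ht.1, h⟩ ht.1)⟩

theorem hasDerivAt_iterate_derivative_eval (f : ℝ[X]) (m : ℕ) (t : ℝ) :
    HasDerivAt (fun t => (derivative^[m] f).eval t) ((derivative^[m + 1] f).eval t) t := by
  rw [Function.iterate_succ_apply']
  exact (derivative^[m] f).hasDerivAt t

/-- By the differential equation the derivative of this energy is (4m+2) t times the square of the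
(m+1)-st derivative, so the maximum is attained at an endpoint. -/
theorem legendreP_energy_le (ℓ m : ℕ) {t : ℝ} (ht : t ∈ Set.Icc (-1 : ℝ) 1) :
    ((ℓ : ℝ) * (ℓ + 1) - m * (m + 1)) * (derivative^[m] (legendreP ℓ)).eval t ^ 2 +
      (1 - t ^ 2) * (derivative^[m + 1] (legendreP ℓ)).eval t ^ 2 ≤
    max (((ℓ : ℝ) * (ℓ + 1) - m * (m + 1)) * (derivative^[m] (legendreP ℓ)).eval 1 ^ 2)
      (((ℓ : ℝ) * (ℓ + 1) - m * (m + 1)) * (derivative^[m] (legendreP ℓ)).eval (-1) ^ 2) := by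
  have h := (le_max_of_hasDerivAt_eq_mul
    (f := fun t => ((ℓ : ℝ) * (ℓ + 1) - m * (m + 1)) * (derivative^[m] (legendreP ℓ)).eval t ^ 2 +
      (1 - t ^ 2) * (derivative^[m + 1] (legendreP ℓ)).eval t ^ 2)
    (φ := fun t => (4 * m + 2) * (derivative^[m + 1] (legendreP ℓ)).eval t ^ 2)
    (by fun_prop) (fun t _ => ?_) (fun t _ => by positivity) ht).2
  · simpa [-Function.iterate_succ] using h
  · have h0 := hasDerivAt_iterate_derivative_eval (legendreP ℓ) m t
    have h1 := hasDerivAt_iterate_derivative_eval (legendreP ℓ) (m + 1) t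
    have ode := eval_legendreP_ode ℓ m t
    refine (((h0.pow 2).const_mul ((ℓ : ℝ) * (ℓ + 1) - m * (m + 1))).add
      ((((hasDerivAt_id t).pow 2).const_sub 1).mul (h1.pow 2))).congr_deriv ?_
    simp [-Function.iterate_succ, add_assoc]
    linear_combination (2 * (derivative^[m + 1] (legendreP ℓ)).eval t) * ode

theorem one_sub_sq_mul_derivative_legendreP_sq_le (ℓ : ℕ) {t : ℝ} (ht : t ∈ Set.Icc (-1 : ℝ) 1) :
    (1 - t ^ 2) * (derivative (legendreP ℓ)).eval t ^ 2 ≤ (ℓ : ℝ) * (ℓ + 1) := by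
  have h := legendreP_energy_le ℓ 0 ht
  simp [legendreP_eval_one, legendreP_eval_neg_one_sq] at h
  have : 0 ≤ (ℓ : ℝ) * (ℓ + 1) * eval t (legendreP ℓ) ^ 2 := by positivity
  linarith

theorem derivative_legendreP_eval_sq_le {ℓ : ℕ} (hℓ : 1 ≤ ℓ) {t : ℝ}
    (ht : t ∈ Set.Icc (-1 : ℝ) 1) :
    (derivative (legendreP ℓ)).eval t ^ 2 ≤ (ℓ : ℝ) ^ 4 := by
  have e1 := eval_legendreP_ode ℓ 0 1
  have e2 := eval_legendreP_ode ℓ 0 (-1)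
  simp [legendreP_eval_one] at e1 e2
  have hl : (1 : ℝ) ≤ ℓ := by exact_mod_cast hℓ
  have hb : ((ℓ : ℝ) * (ℓ + 1)) ^ 2 / 4 ≤ ℓ ^ 4 := by
    have : (ℓ : ℝ) + 1 ≤ 2 * ℓ := by linarith
    have h2 : ((ℓ : ℝ) + 1) ^ 2 ≤ (2 * ℓ) ^ 2 := by gcongr
    nlinarith [sq_nonneg (ℓ : ℝ)]
  have e3 : (derivative (legendreP ℓ)).eval 1 ^ 2 = ((ℓ : ℝ) * (ℓ + 1)) ^ 2 / 4 := by
    have : (derivative (legendreP ℓ)).eval 1 = (ℓ : ℝ) * (ℓ + 1) / 2 := by linarith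
    rw [this]; ring
  have e4 : (derivative (legendreP ℓ)).eval (-1) ^ 2 = ((ℓ : ℝ) * (ℓ + 1)) ^ 2 / 4 := by
    have : (derivative (legendreP ℓ)).eval (-1) =
      -((ℓ : ℝ) * (ℓ + 1) / 2) * (legendreP ℓ).eval (-1) := by linarith
    rw [this, mul_pow, legendreP_eval_neg_one_sq]; ring
  -- The energy with m = 1 has coefficient ℓ(ℓ+1) - 2, which is positive only for ℓ ≥ 2. For ℓ = 1
  -- the derivative is constant.
  rcases hℓ.eq_or_lt with h1 | h1
  · have hdeg : (derivative (legendreP ℓ)).natDegree = 0 := by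
      have := natDegree_derivative_le (legendreP ℓ)
      have := natDegree_legendreP_le ℓ
      omega
    rw [eq_C_of_natDegree_eq_zero hdeg, eval_C] at e3 ⊢
    linarith
  · have h := legendreP_energy_le ℓ 1 ht
    simp [e3, e4] at h
    have h2 : (2 : ℝ) ≤ ℓ := by exact_mod_cast h1
    have hμ : 0 < (ℓ : ℝ) * (ℓ + 1) - (1 + 1) := by nlinarith
    have h3 : 0 ≤ (1 - t ^ 2) * eval t (derivative (derivative (legendreP ℓ))) ^ 2 := by
      refine mul_nonneg ?_ (sq_nonneg _)
      nlinarith [ht.1, ht.2]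
    refine le_trans (le_of_mul_le_mul_left ?_ hμ) hb
    linarith

/-! ### Values at the equator and Sonin's function. -/

theorem centralBinom_div_sq_le (k : ℕ) :
    ((k.centralBinom : ℝ) / 4 ^ k) ^ 2 * (2 * k + 1) ≤ 1 := by
  induction k with
  | zero => simp
  | succ k ih =>
    have h : ((k : ℝ) + 1) * (k + 1).centralBinom = 2 * (2 * k + 1) * k.centralBinom := by
      exact_mod_cast Nat.succ_mul_centralBinom_succ k
    have e : ((k + 1).centralBinom : ℝ) / 4 ^ (k + 1) =
        (2 * k + 1) / (2 * k + 2) * (k.centralBinom / 4 ^ k) := by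
      rw [pow_succ]
      field_simp
      linear_combination 2 * h
    rw [e, mul_pow]
    refine le_trans ?_ ih
    push_cast
    rw [mul_comm (((2 * k + 1 : ℝ) / (2 * k + 2)) ^ 2), mul_assoc]
    refine mul_le_mul_of_nonneg_left ?_ (by positivity)
    rw [div_pow, div_mul_eq_mul_div, div_le_iff₀ (by positivity)]
    nlinarith [(Nat.cast_nonneg k : (0 : ℝ) ≤ k)]

/-- The value at 0 is a factorial times one coefficient of (X²-1)^ℓ, read off from the binomial
expansion of (X-1)^ℓ after substituting X² for X. -/
theorem iterate_derivative_legendreP_eval_zero (ℓ m : ℕ) :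
    (derivative^[m] (legendreP ℓ)).eval 0 = (2 ^ ℓ * (Nat.factorial ℓ : ℝ))⁻¹ *
      ((ℓ + m).factorial * if 2 ∣ ℓ + m then
        (-1) ^ (ℓ - (ℓ + m) / 2) * (ℓ.choose ((ℓ + m) / 2) : ℝ) else 0) := by
  have h : (X ^ 2 - 1 : ℝ[X]) ^ ℓ = expand ℝ 2 ((X + C (-1)) ^ ℓ) := by
    simp [sub_eq_add_neg]
  rw [iterate_derivative_legendreP, eval_mul, eval_C, ← coeff_zero_eq_eval_zero,
    coeff_iterate_derivative, zero_add, Nat.descFactorial_self, nsmul_eq_mul, h,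
    coeff_expand two_pos, coeff_X_add_C_pow]

theorem legendreP_eval_zero_sq_le (ℓ : ℕ) : (legendreP ℓ).eval 0 ^ 2 * (ℓ + 1) ≤ 1 := by
  have h := iterate_derivative_legendreP_eval_zero ℓ 0
  simp only [add_zero, Function.iterate_zero, id] at h
  split_ifs at h with h2
  · obtain ⟨k, rfl⟩ := h2
    have : (((2 * k).factorial : ℝ)) ≠ 0 := by positivity
    rw [Nat.mul_div_cancel_left _ two_pos, ← Nat.centralBinom_eq_two_mul_choose, pow_mul] at h
    have e : (legendreP (2 * k)).eval 0 ^ 2 = (k.centralBinom / 4 ^ k) ^ 2 := by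
      rw [h, mul_inv]
      norm_num
      field_simp
      rw [← pow_mul, mul_comm (_ - _) 2, pow_mul]
      norm_num
    rw [e]
    simpa using centralBinom_div_sq_le k
  · rw [h]; simp

theorem derivative_legendreP_eval_zero_sq_le (ℓ : ℕ) :
    (derivative (legendreP ℓ)).eval 0 ^ 2 ≤ ℓ + 1 := by
  have h := iterate_derivative_legendreP_eval_zero ℓ 1
  simp only [Function.iterate_one] at h
  split_ifs at h with h2
  · obtain ⟨k, rfl⟩ : ∃ k, ℓ = 2 * k + 1 := ⟨(ℓ - 1) / 2, by omega⟩
    have h0 : (((2 * k + 1).factorial : ℝ)) ≠ 0 := by positivity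
    rw [show (2 * k + 1 + 1) / 2 = k + 1 by omega] at h
    have hc : ((k + 1).centralBinom : ℝ) = 2 * ((2 * k + 1).choose (k + 1) : ℝ) := by
      have h1 : (2 * (k + 1)).choose (k + 1) =
          (2 * k + 1).choose k + (2 * k + 1).choose (k + 1) := by
        rw [show 2 * (k + 1) = (2 * k + 1) + 1 by ring, Nat.choose_succ_succ]
      have h3 : (2 * k + 1).choose k = (2 * k + 1).choose (k + 1) :=
        (Nat.choose_symm_half k).symm
      rw [Nat.centralBinom_eq_two_mul_choose, h1, h3]
      push_cast; ring
    have e : (derivative (legendreP (2 * k + 1))).eval 0 ^ 2 =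
        (2 * k + 2) ^ 2 * ((k + 1).centralBinom / 4 ^ (k + 1)) ^ 2 := by
      rw [h, hc, Nat.factorial_succ (2 * k + 1), mul_inv]
      have e4 : (4 : ℝ) ^ (k + 1) = 2 * 2 ^ (2 * k + 1) := by
        rw [show (4 : ℝ) = 2 ^ 2 by norm_num, ← pow_mul]; ring
      rw [e4]
      push_cast
      field_simp
      rw [← pow_mul, mul_comm (_ - _) 2, pow_mul]
      norm_num
      ring
    have hb := centralBinom_div_sq_le (k + 1)
    rw [e]
    push_cast at hb ⊢
    nlinarith [(Nat.cast_nonneg k : (0 : ℝ) ≤ k),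
      sq_nonneg (((k + 1).centralBinom : ℝ) / 4 ^ (k + 1))]
  · rw [h]; simp; positivity

/-- The function u(θ) = √(sin θ) P(cos θ) solves u'' + φu = 0 with φ = (ℓ+1/2)² + 1/(4 sin²θ).
Sonin's function u² + u'²/φ has θ-derivative -φ'u'²/φ², hence is largest at the equator. It is
written here in t = cos θ, with a minus sign so that the equator becomes a minimum. -/
theorem hasDerivAt_sonin (ℓ : ℕ) {t : ℝ} (ht : t ∈ Set.Ioo (-1 : ℝ) 1) :
    HasDerivAt (fun t => -(√(1 - t ^ 2) * ((legendreP ℓ).eval t ^ 2 +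
      4 * ((1 - t ^ 2) * (derivative (legendreP ℓ)).eval t - t * (legendreP ℓ).eval t / 2) ^ 2 /
        ((1 - t ^ 2) * (2 * ℓ + 1) ^ 2 + 1))))
      (t * (8 * ((1 - t ^ 2) * (derivative (legendreP ℓ)).eval t -
        t * (legendreP ℓ).eval t / 2) ^ 2 /
          (√(1 - t ^ 2) * ((1 - t ^ 2) * (2 * ℓ + 1) ^ 2 + 1) ^ 2))) t := by
  have hw : 0 < 1 - t ^ 2 := by nlinarith [ht.1, ht.2]
  have hd : (1 - t ^ 2) * (2 * (ℓ : ℝ) + 1) ^ 2 + 1 ≠ 0 := by positivity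
  have h0 := (legendreP ℓ).hasDerivAt t
  have h1 := (derivative (legendreP ℓ)).hasDerivAt t
  have ode := eval_legendreP_ode ℓ 0 t
  simp only [zero_add, Function.iterate_succ, Function.iterate_zero, Function.comp, id] at ode
  have hi := hasDerivAt_id t
  have hw' := (hi.pow 2).const_sub 1
  simp only [id, Nat.cast_ofNat, Nat.add_one_sub_one, pow_one, mul_one] at hw'
  have hs := hw'.sqrt (by simpa using hw.ne')
  have hv := (hw'.mul h1).sub ((hi.mul h0).div_const 2)
  have hE := (hs.mul ((h0.pow 2).add (((hv.pow 2).const_mul 4).div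
    ((hw'.mul_const ((2 * (ℓ : ℝ) + 1) ^ 2)).add_const 1) (by simpa using hd)))).neg
  refine hE.congr_deriv ?_
  have hs2 : √(1 - t ^ 2) ^ 2 = 1 - t ^ 2 := Real.sq_sqrt hw.le
  have hs0 : √(1 - t ^ 2) ≠ 0 := (Real.sqrt_pos.mpr hw).ne'
  simp only [Pi.pow_apply, Pi.mul_apply, Pi.sub_apply, Pi.add_apply, Pi.div_apply, id,
    Nat.cast_ofNat, Nat.add_one_sub_one, pow_one, one_mul]
  generalize eval t (derivative (derivative (legendreP ℓ))) = p2 at *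
  generalize eval t (derivative (legendreP ℓ)) = p1 at *
  generalize eval t (legendreP ℓ) = p0 at *
  generalize √(1 - t ^ 2) = s at *
  have hp : (1 - t ^ 2) * p2 = 2 * t * p1 - ℓ * (ℓ + 1) * p0 := by
    push_cast at ode
    linarith
  rw [hp]
  field_simp
  rw [hs2]
  ring

/-- At t = 0 the two summands are P(0)² and 4P'(0)²/((2ℓ+1)²+1), each at most 1/ℓ by the central
binomial estimate. -/
theorem sonin_le {ℓ : ℕ} (hℓ : 1 ≤ ℓ) {t : ℝ} (ht : t ∈ Set.Icc (-1 : ℝ) 1) :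
    √(1 - t ^ 2) * ((legendreP ℓ).eval t ^ 2 +
      4 * ((1 - t ^ 2) * (derivative (legendreP ℓ)).eval t - t * (legendreP ℓ).eval t / 2) ^ 2 /
        ((1 - t ^ 2) * (2 * ℓ + 1) ^ 2 + 1)) ≤ 2 / ℓ := by
  have hpos : ∀ t ∈ Set.Icc (-1 : ℝ) 1, 0 ≤ 1 - t ^ 2 := fun t ht => by nlinarith [ht.1, ht.2]
  have h := (le_max_of_hasDerivAt_eq_mul ?_ (fun t ht => hasDerivAt_sonin ℓ ht)
    (fun t ht => by positivity) ht).1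
  · rw [neg_le_neg_iff] at h
    refine h.trans ?_
    have hl : (1 : ℝ) ≤ ℓ := by exact_mod_cast hℓ
    have h0 := legendreP_eval_zero_sq_le ℓ
    have h1 := derivative_legendreP_eval_zero_sq_le ℓ
    have e0 : (legendreP ℓ).eval 0 ^ 2 ≤ 1 / ℓ := by
      rw [le_div_iff₀ (by positivity)]
      nlinarith [sq_nonneg ((legendreP ℓ).eval 0)]
    have e1 : 4 * (derivative (legendreP ℓ)).eval 0 ^ 2 / ((2 * (ℓ : ℝ) + 1) ^ 2 + 1) ≤ 1 / ℓ := by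
      rw [div_le_div_iff₀ (by positivity) (by positivity)]
      nlinarith
    have e2 : 2 / (ℓ : ℝ) = 1 / ℓ + 1 / ℓ := by ring
    rw [e2]
    simpa using add_le_add e0 e1
  · refine ContinuousOn.neg (ContinuousOn.mul (by fun_prop) (ContinuousOn.add (by fun_prop) ?_))
    refine ContinuousOn.div (by fun_prop) (by fun_prop) fun t ht => ?_
    have := hpos t ht
    positivity

/-- The Bernstein-type bound for the derivative of a Legendre polynomial. -/
theorem sqrt_pow_three_mul_derivative_legendreP_sq_le {ℓ : ℕ} (hℓ : 1 ≤ ℓ) {t : ℝ}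
    (ht : t ∈ Set.Icc (-1 : ℝ) 1) :
    √(1 - t ^ 2) ^ 3 * (derivative (legendreP ℓ)).eval t ^ 2 ≤ 11 * ℓ := by
  have hS := sonin_le hℓ ht
  have hG := one_sub_sq_mul_derivative_legendreP_sq_le ℓ ht
  have hw : 0 ≤ 1 - t ^ 2 := by nlinarith [ht.1, ht.2]
  have hl : (1 : ℝ) ≤ ℓ := by exact_mod_cast hℓ
  have hs2 : √(1 - t ^ 2) ^ 2 = 1 - t ^ 2 := Real.sq_sqrt hw
  have hs0 : 0 ≤ √(1 - t ^ 2) := Real.sqrt_nonneg _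
  have ht2 : t ^ 2 ≤ 1 := by linarith
  rw [← hs2, Real.sqrt_sq hs0] at hS
  rw [← hs2] at hG
  generalize √(1 - t ^ 2) = s at *
  generalize eval t (derivative (legendreP ℓ)) = p1 at *
  generalize eval t (legendreP ℓ) = p0 at *
  -- Away from the poles (ℓ sin θ ≥ 1) Sonin's bound controls s²P' up to the correction tP/2. Near
  -- the poles the energy bound s²P'² ≤ ℓ(ℓ+1) is enough.
  rcases le_total (1 / (ℓ : ℝ)) s with h | h
  · have hsp : 0 < s := lt_of_lt_of_le (by positivity) h
    have hd : 0 < s ^ 2 * (2 * (ℓ : ℝ) + 1) ^ 2 + 1 := by positivity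
    set v := s ^ 2 * p1 - t * p0 / 2 with hv
    have a1 : s * p0 ^ 2 ≤ 2 / ℓ := by
      refine le_trans ?_ hS
      gcongr
      have : 0 ≤ 4 * v ^ 2 / (s ^ 2 * (2 * (ℓ : ℝ) + 1) ^ 2 + 1) := by positivity
      linarith
    have a2 : s * (4 * v ^ 2) ≤ 2 / ℓ * (s ^ 2 * (2 * (ℓ : ℝ) + 1) ^ 2 + 1) := by
      rw [← div_le_iff₀ hd, mul_div_assoc]
      refine le_trans ?_ hS
      gcongr
      have : 0 ≤ p0 ^ 2 := sq_nonneg _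
      linarith
    have a3 : (s ^ 2 * p1) ^ 2 ≤ 2 * v ^ 2 + p0 ^ 2 / 2 := by
      have h1 : s ^ 2 * p1 = v + t * p0 / 2 := by rw [hv]; ring
      rw [h1]
      nlinarith [sq_nonneg (v - t * p0 / 2), mul_le_mul_of_nonneg_right ht2 (sq_nonneg p0)]
    have hls : 1 ≤ ℓ * s := by rwa [div_le_iff₀' (by positivity)] at h
    have a4 : (2 * (ℓ : ℝ) + 1) ^ 2 ≤ 9 * ℓ ^ 2 := by nlinarith
    have a5 : 1 ≤ (ℓ * s) ^ 2 := one_le_pow₀ hls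
    have a6 : s * (s ^ 2 * p1) ^ 2 ≤ 11 * ℓ * s ^ 2 := by
      calc s * (s ^ 2 * p1) ^ 2 ≤ s * (2 * v ^ 2 + p0 ^ 2 / 2) := by gcongr
        _ = s * (4 * v ^ 2) / 2 + s * p0 ^ 2 / 2 := by ring
        _ ≤ (2 / ℓ * (s ^ 2 * (2 * (ℓ : ℝ) + 1) ^ 2 + 1)) / 2 + (2 / ℓ) / 2 := by gcongr
        _ = (s ^ 2 * (2 * (ℓ : ℝ) + 1) ^ 2 + 2) / ℓ := by ring
        _ ≤ (s ^ 2 * (9 * ℓ ^ 2) + 2 * (ℓ * s) ^ 2) / ℓ := by gcongr; linarith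
        _ = 11 * ℓ * s ^ 2 := by field_simp; ring
    refine le_of_mul_le_mul_right (a := s ^ 2) ?_ (by positivity)
    linarith
  · have hls : ℓ * s ≤ 1 := by rwa [le_div_iff₀' (by positivity)] at h
    calc s ^ 3 * p1 ^ 2 = s * (s ^ 2 * p1 ^ 2) := by ring
      _ ≤ s * (ℓ * (ℓ + 1)) := by gcongr
      _ = (ℓ * s) * (ℓ + 1) := by ring
      _ ≤ 1 * (ℓ + 1) := by gcongr
      _ ≤ 11 * ℓ := by linarith

/-! ### Integrals of derivatives of Legendre polynomials in the angle. -/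

theorem abs_derivative_legendreP_cos_le {ℓ : ℕ} (hℓ : 1 ≤ ℓ) {θ : ℝ} (hθ : 0 ≤ Real.sin θ) :
    |(derivative (legendreP ℓ)).eval (Real.cos θ)| ≤
      7 * ℓ ^ 2 * (1 + ℓ * Real.sin θ) ^ (-(3 / 2) : ℝ) := by
  have ht : Real.cos θ ∈ Set.Icc (-1 : ℝ) 1 := ⟨Real.neg_one_le_cos θ, Real.cos_le_one θ⟩
  have h1 := sqrt_pow_three_mul_derivative_legendreP_sq_le hℓ ht
  have h2 := derivative_legendreP_eval_sq_le hℓ ht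
  rw [← Real.sin_sq, Real.sqrt_sq hθ] at h1
  have hl : (1 : ℝ) ≤ ℓ := by exact_mod_cast hℓ
  generalize eval (Real.cos θ) (derivative (legendreP ℓ)) = p at *
  generalize Real.sin θ = s at *
  have hb : 0 < 1 + ℓ * s := by positivity
  refine abs_le_of_sq_le_sq ?_ (by positivity)
  have e : ((1 + ℓ * s) ^ (-(3 / 2) : ℝ)) ^ 2 = ((1 + ℓ * s) ^ 3)⁻¹ := by
    rw [← Real.rpow_natCast, ← Real.rpow_mul hb.le, ← Real.rpow_natCast, ← Real.rpow_neg hb.le]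
    norm_num
  rw [mul_pow, e, ← div_eq_mul_inv, le_div_iff₀ (by positivity)]
  -- This splits the target into the uniform bound p² ≤ ℓ⁴ and the Bernstein bound, with total
  -- constant 4 + 44 ≤ 7².
  have h3 : (1 + ℓ * s) ^ 3 ≤ 4 * (1 + (ℓ * s) ^ 3) := by
    have : 0 ≤ ℓ * s := by positivity
    nlinarith [mul_nonneg (add_nonneg this zero_le_one) (sq_nonneg (ℓ * s - 1))]
  have h4 : (ℓ : ℝ) ^ 3 * (s ^ 3 * p ^ 2) ≤ ℓ ^ 3 * (11 * ℓ) := by gcongr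
  calc p ^ 2 * (1 + ℓ * s) ^ 3 ≤ p ^ 2 * (4 * (1 + (ℓ * s) ^ 3)) := by gcongr
    _ = 4 * p ^ 2 + 4 * (ℓ ^ 3 * (s ^ 3 * p ^ 2)) := by ring
    _ ≤ 4 * ℓ ^ 4 + 4 * (ℓ ^ 3 * (11 * ℓ)) := by gcongr
    _ ≤ (7 * ℓ ^ 2) ^ 2 := by nlinarith [pow_pos (lt_of_lt_of_le one_pos hl) 4]

theorem integral_one_add_mul_rpow_le {b : ℝ} (hb : 0 < b) :
    ∫ θ in (0 : ℝ)..Real.pi, (1 + b * θ) ^ (-(3 / 2) : ℝ) ≤ 2 / b := by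
  have hd : ∀ θ ∈ Set.uIcc 0 Real.pi,
      HasDerivAt (fun θ : ℝ => -(2 / b) * (1 + b * θ) ^ (-(1 / 2) : ℝ))
        ((1 + b * θ) ^ (-(3 / 2) : ℝ)) θ := by
    intro θ hθ
    rw [Set.uIcc_of_le Real.pi_pos.le] at hθ
    have hp : 0 < 1 + b * θ := by have := hθ.1; positivity
    have h := ((((hasDerivAt_id θ).const_mul b).const_add 1).rpow_const
      (p := (-(1 / 2) : ℝ)) (Or.inl hp.ne')).const_mul (-(2 / b))
    refine h.congr_deriv ?_
    simp only [id]
    rw [show (-(1 / 2) - 1 : ℝ) = -(3 / 2) by norm_num]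
    field_simp
  rw [intervalIntegral.integral_eq_sub_of_hasDerivAt hd]
  · have : 0 ≤ (1 + b * Real.pi) ^ (-(1 / 2) : ℝ) := by
      have := Real.pi_pos
      positivity
    have h2 : 0 ≤ 2 / b * (1 + b * Real.pi) ^ (-(1 / 2) : ℝ) := by positivity
    simp
    simpa using h2
  · apply ContinuousOn.intervalIntegrable
    intro θ hθ
    rw [Set.uIcc_of_le Real.pi_pos.le] at hθ
    have hp : 0 < 1 + b * θ := by have := hθ.1; positivity
    exact ContinuousWithinAt.rpow_const (by fun_prop) (Or.inl hp.ne')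

theorem integral_abs_derivative_legendreP_cos_le {ℓ : ℕ} (hℓ : 1 ≤ ℓ) :
    ∫ θ in (0 : ℝ)..Real.pi, |(derivative (legendreP ℓ)).eval (Real.cos θ)| ≤
      14 * Real.pi * ℓ := by
  have hl : (1 : ℝ) ≤ ℓ := by exact_mod_cast hℓ
  have hpi := Real.pi_pos
  -- The slope comes from Jordan's inequality sin θ ≥ 2θ/π on [0, π/2], reflected on the other half.
  -- The decay exponent 3/2 exceeds 1, so the integral of the majorant is of order 1/b, which lowers
  -- ℓ² to ℓ.
  set b : ℝ := 2 * ℓ / Real.pi with hb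
  have hb0 : 0 < b := by positivity
  set ψ : ℝ → ℝ := fun θ => (1 + b * θ) ^ (-(3 / 2) : ℝ) with hψ
  have hψi : IntervalIntegrable ψ volume 0 Real.pi := by
    apply ContinuousOn.intervalIntegrable
    intro θ hθ
    rw [Set.uIcc_of_le hpi.le] at hθ
    have hp : 0 < 1 + b * θ := by have := hθ.1; positivity
    exact ContinuousWithinAt.rpow_const (by fun_prop) (Or.inl hp.ne')
  have hψi' : IntervalIntegrable (fun θ => ψ (Real.pi - θ)) volume 0 Real.pi := by
    simpa using (hψi.comp_sub_left Real.pi).symm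
  have hψpos : ∀ x, 0 ≤ x → 0 ≤ ψ x := fun x hx => by positivity
  have hkey : ∀ θ s : ℝ, 0 ≤ θ → b * θ ≤ ℓ * s → (1 + ℓ * s) ^ (-(3 / 2) : ℝ) ≤ ψ θ := by
    intro θ s h0 h
    exact Real.rpow_le_rpow_of_nonpos (by positivity) (by linarith) (by norm_num)
  have hsin : ∀ θ, 0 ≤ θ → θ ≤ Real.pi / 2 → b * θ ≤ ℓ * Real.sin θ := by
    intro θ h0 h1
    have := Real.mul_le_sin h0 h1
    calc b * θ = ℓ * (2 / Real.pi * θ) := by rw [hb]; ring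
      _ ≤ _ := by gcongr
  calc ∫ θ in (0 : ℝ)..Real.pi, |(derivative (legendreP ℓ)).eval (Real.cos θ)|
      ≤ ∫ θ in (0 : ℝ)..Real.pi, 7 * ℓ ^ 2 * (ψ θ + ψ (Real.pi - θ)) := by
        refine intervalIntegral.integral_mono_on hpi.le ?_ ((hψi.add hψi').const_mul _) ?_
        · exact Continuous.intervalIntegrable (by fun_prop) _ _
        · intro θ hθ
          refine (abs_derivative_legendreP_cos_le hℓ (Real.sin_nonneg_of_mem_Icc hθ)).trans ?_
          have p1 := hψpos θ hθ.1
          have p2 := hψpos (Real.pi - θ) (by linarith [hθ.2])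
          gcongr
          rcases le_total θ (Real.pi / 2) with h | h
          · linarith [hkey θ _ hθ.1 (hsin θ hθ.1 h)]
          · have := hsin (Real.pi - θ) (by linarith [hθ.2]) (by linarith)
            rw [Real.sin_pi_sub] at this
            linarith [hkey (Real.pi - θ) _ (by linarith [hθ.2]) this]
    _ = 7 * ℓ ^ 2 * (2 * ∫ θ in (0 : ℝ)..Real.pi, ψ θ) := by
        rw [intervalIntegral.integral_const_mul, intervalIntegral.integral_add hψi hψi',
          intervalIntegral.integral_comp_sub_left (fun θ => ψ θ)]
        simp only [sub_self, sub_zero]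
        ring
    _ ≤ 7 * ℓ ^ 2 * (2 * (2 / b)) := by
        gcongr
        exact integral_one_add_mul_rpow_le hb0
    _ = 14 * Real.pi * ℓ := by rw [hb]; field_simp; ring

/-- The triple product of derivatives of Legendre polynomials. -/
theorem integralPoly_triple_derivative_legendreP_le {a b c : ℕ} (ha : 1 ≤ a) (hb : 1 ≤ b)
    (hc : 1 ≤ c) :
    integralPoly ((1 - X ^ 2) * (derivative (legendreP a) * derivative (legendreP b)) *
      derivative (legendreP c)) ≤ 154 * Real.pi * a * √(b * c) := by
  -- Under t = cos θ the weight 1-t² and dt combine to sin³θ dθ, exactly what two Bernstein factors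
  -- of weight sin^{3/2}θ consume.
  have hsub := intervalIntegral.integral_comp_mul_deriv (a := 0) (b := Real.pi)
    (f := Real.cos) (f' := fun θ => -Real.sin θ)
    (g := fun t => ((1 - X ^ 2) * (derivative (legendreP a) * derivative (legendreP b)) *
      derivative (legendreP c)).eval t) (fun θ _ => Real.hasDerivAt_cos θ)
    (by fun_prop) (Polynomial.continuous _)
  rw [Real.cos_zero, Real.cos_pi, intervalIntegral.integral_symm (-1) 1,
    ← integralPoly_apply] at hsub
  rw [← neg_eq_iff_eq_neg.mpr hsub, ← intervalIntegral.integral_neg]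
  have hpi := Real.pi_pos
  calc _ ≤ ∫ θ in (0 : ℝ)..Real.pi,
        11 * √(b * c) * |(derivative (legendreP a)).eval (Real.cos θ)| := by
        refine intervalIntegral.integral_mono_on hpi.le
          (Continuous.intervalIntegrable (by fun_prop) _ _)
          (Continuous.intervalIntegrable (by fun_prop) _ _) ?_
        intro θ hθ
        have hs : 0 ≤ Real.sin θ := Real.sin_nonneg_of_mem_Icc hθ
        have ht : Real.cos θ ∈ Set.Icc (-1 : ℝ) 1 := ⟨Real.neg_one_le_cos θ, Real.cos_le_one θ⟩
        have h1 := sqrt_pow_three_mul_derivative_legendreP_sq_le hb ht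
        have h2 := sqrt_pow_three_mul_derivative_legendreP_sq_le hc ht
        rw [← Real.sin_sq, Real.sqrt_sq hs] at h1 h2
        simp only [Function.comp, eval_mul, eval_sub, eval_one, eval_pow, eval_X]
        rw [← Real.sin_sq]
        generalize eval (Real.cos θ) (derivative (legendreP a)) = pa at *
        generalize eval (Real.cos θ) (derivative (legendreP b)) = pb at *
        generalize eval (Real.cos θ) (derivative (legendreP c)) = pc at *
        generalize Real.sin θ = s at *
        have h3 : |s ^ 3 * (pb * pc)| ≤ 11 * √(b * c) := by
          refine abs_le_of_sq_le_sq ?_ (by positivity)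
          rw [mul_pow (11 : ℝ), Real.sq_sqrt (by positivity)]
          calc (s ^ 3 * (pb * pc) : ℝ) ^ 2 = (s ^ 3 * pb ^ 2) * (s ^ 3 * pc ^ 2) := by ring
            _ ≤ (11 * (b : ℝ)) * (11 * (c : ℝ)) := by gcongr
            _ = 11 ^ 2 * ((b : ℝ) * (c : ℝ)) := by ring
        calc _ = (s ^ 3 * (pb * pc)) * pa := by ring
          _ ≤ |(s ^ 3 * (pb * pc)) * pa| := le_abs_self _
          _ = |s ^ 3 * (pb * pc)| * |pa| := abs_mul _ _
          _ ≤ _ := by gcongr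
    _ = 11 * √(b * c) * ∫ θ in (0 : ℝ)..Real.pi,
        |(derivative (legendreP a)).eval (Real.cos θ)| := by
        rw [intervalIntegral.integral_const_mul]
    _ ≤ 11 * √(b * c) * (14 * Real.pi * a) := by
        gcongr
        exact integral_abs_derivative_legendreP_cos_le ha
    _ = _ := by ring

end LegendreBounds

/-! ### Polynomials on the sphere and infinitesimal rotations -/

section SphereCalculus

open MvPolynomial

/-- Evaluation of a polynomial in three variables at a point of the sphere. -/
noncomputable abbrev sphereEval (p : UnitSphere2) : MvPolynomial (Fin 3) ℝ →+* ℝ :=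
  eval (fun i => (p : EuclideanSpace ℝ (Fin 3)) i)

/-- The surface measure of the sphere. -/
noncomputable abbrev sphereMeasure : Measure UnitSphere2 :=
  (volume : Measure (EuclideanSpace ℝ (Fin 3))).toSphere

theorem UnitSphere2.sum_sq (p : UnitSphere2) :
    (p : EuclideanSpace ℝ (Fin 3)) 0 ^ 2 + (p : EuclideanSpace ℝ (Fin 3)) 1 ^ 2 +
      (p : EuclideanSpace ℝ (Fin 3)) 2 ^ 2 = 1 := by
  have h : ‖(p : EuclideanSpace ℝ (Fin 3))‖ ^ 2 = 1 := by simp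
  rw [EuclideanSpace.norm_sq_eq, Fin.sum_univ_three] at h
  simpa using h

theorem continuous_sphere_coord (i : Fin 3) :
    Continuous fun p : UnitSphere2 => (p : EuclideanSpace ℝ (Fin 3)) i := by
  fun_prop

theorem continuous_sphereEval (F : MvPolynomial (Fin 3) ℝ) :
    Continuous fun p => sphereEval p F :=
  (MvPolynomial.continuous_eval F).comp (continuous_pi continuous_sphere_coord)

theorem integrable_sphere {f : UnitSphere2 → ℝ} (hf : Continuous f) :
    Integrable f sphereMeasure :=
  hf.integrable_of_hasCompactSupport (HasCompactSupport.of_compactSpace f)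

/-- The map of the sphere induced by a linear isometry. -/
noncomputable def sphereIsometry (g : EuclideanSpace ℝ (Fin 3) ≃ₗᵢ[ℝ] EuclideanSpace ℝ (Fin 3))
    (p : UnitSphere2) : UnitSphere2 :=
  ⟨g p, by simp⟩

theorem continuous_sphereIsometry
    (g : EuclideanSpace ℝ (Fin 3) ≃ₗᵢ[ℝ] EuclideanSpace ℝ (Fin 3)) :
    Continuous (sphereIsometry g) :=
  (g.continuous.comp continuous_subtype_val).subtype_mk _

open scoped Pointwise in
-- The surface measure of a set is a multiple of the volume of the cone over it. A linear isometry
-- maps cones to cones and preserves volume.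
theorem measurePreserving_sphereIsometry
    (g : EuclideanSpace ℝ (Fin 3) ≃ₗᵢ[ℝ] EuclideanSpace ℝ (Fin 3)) :
    MeasurePreserving (sphereIsometry g) sphereMeasure sphereMeasure := by
  refine ⟨(continuous_sphereIsometry g).measurable, ?_⟩
  ext s hs
  have hm := (continuous_sphereIsometry g).measurable hs
  rw [Measure.map_apply (continuous_sphereIsometry g).measurable hs,
    Measure.toSphere_apply' _ hm, Measure.toSphere_apply' _ hs]
  have hset : Set.Ioo (0 : ℝ) 1 • (Subtype.val '' (sphereIsometry g ⁻¹' s)) =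
      g ⁻¹' (Set.Ioo (0 : ℝ) 1 • (Subtype.val '' s)) := by
    ext x
    simp only [Set.mem_smul, Set.mem_image, Set.mem_preimage]
    constructor
    · rintro ⟨r, hr, _, ⟨p, hp, rfl⟩, rfl⟩
      exact ⟨r, hr, _, ⟨_, hp, rfl⟩, by simp [sphereIsometry]⟩
    · rintro ⟨r, hr, _, ⟨p, hp, rfl⟩, h⟩
      refine ⟨r, hr, _, ⟨sphereIsometry g.symm p, ?_, rfl⟩, ?_⟩
      · have : sphereIsometry g (sphereIsometry g.symm p) = p :=
          Subtype.ext (g.apply_symm_apply _)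
        simpa [this] using hp
      · apply g.injective
        simp [sphereIsometry, h]
  rw [hset, g.measurePreserving.measure_preimage_emb g.toHomeomorph.measurableEmbedding]

/-- The rotation by the angle `θ` about the coordinate axis `i`. -/
noncomputable def axisRotationFun (i : Fin 3) (θ : ℝ) (x : Fin 3 → ℝ) (j : Fin 3) : ℝ :=
  if j = i then x i
  else if j = i + 1 then Real.cos θ * x (i + 1) - Real.sin θ * x (i + 2)
  else Real.sin θ * x (i + 1) + Real.cos θ * x (i + 2)

theorem axisRotationFun_sum_sq (i : Fin 3) (θ : ℝ) (x : Fin 3 → ℝ) :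
    axisRotationFun i θ x 0 ^ 2 + axisRotationFun i θ x 1 ^ 2 + axisRotationFun i θ x 2 ^ 2 =
      x 0 ^ 2 + x 1 ^ 2 + x 2 ^ 2 := by
  have h := Real.sin_sq_add_cos_sq θ
  fin_cases i
  · simp [axisRotationFun]
    linear_combination (x 1 ^ 2 + x 2 ^ 2) * h
  · simp [axisRotationFun]
    linear_combination (x 0 ^ 2 + x 2 ^ 2) * h
  · simp [axisRotationFun]
    linear_combination (x 0 ^ 2 + x 1 ^ 2) * h

theorem axisRotationFun_zero (i : Fin 3) (x : Fin 3 → ℝ) : axisRotationFun i 0 x = x := by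
  ext j
  fin_cases i <;> fin_cases j <;> simp [axisRotationFun]

/-- The rotation about a coordinate axis, as a linear isometry. -/
noncomputable def axisRotation (i : Fin 3) (θ : ℝ) :
    EuclideanSpace ℝ (Fin 3) ≃ₗᵢ[ℝ] EuclideanSpace ℝ (Fin 3) :=
  LinearIsometry.toLinearIsometryEquiv
    { toFun := fun x => WithLp.toLp 2 (axisRotationFun i θ x)
      map_add' := fun x y => by
        ext j
        simp only [axisRotationFun, PiLp.add_apply]
        split_ifs <;> ring
      map_smul' := fun c x => by
        ext j
        simp only [axisRotationFun, PiLp.smul_apply, smul_eq_mul, RingHom.id_apply]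
        split_ifs <;> ring
      norm_map' := fun x => by
        simp only [LinearMap.coe_mk, AddHom.coe_mk]
        rw [EuclideanSpace.norm_eq, EuclideanSpace.norm_eq, Fin.sum_univ_three,
          Fin.sum_univ_three]
        simpa using congrArg Real.sqrt (axisRotationFun_sum_sq i θ x) }
    rfl

/-- The derivative along the velocity field `x ↦ a × x` of the rotations about `a`. -/
noncomputable def rotDer (a : Fin 3 → ℝ) :
    Derivation ℝ (MvPolynomial (Fin 3) ℝ) (MvPolynomial (Fin 3) ℝ) :=
  mkDerivation ℝ ![C (a 1) * X 2 - C (a 2) * X 1, C (a 2) * X 0 - C (a 0) * X 2,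
    C (a 0) * X 1 - C (a 1) * X 0]

theorem rotDer_X (a : Fin 3 → ℝ) (j : Fin 3) :
    rotDer a (X j) = ![C (a 1) * X 2 - C (a 2) * X 1, C (a 2) * X 0 - C (a 0) * X 2,
      C (a 0) * X 1 - C (a 1) * X 0] j := by
  rw [rotDer, mkDerivation_X]

theorem rotDer_X_zero (a : Fin 3 → ℝ) : rotDer a (X 0) = C (a 1) * X 2 - C (a 2) * X 1 :=
  rotDer_X a 0

theorem rotDer_X_one (a : Fin 3 → ℝ) : rotDer a (X 1) = C (a 2) * X 0 - C (a 0) * X 2 :=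
  rotDer_X a 1

theorem rotDer_X_two (a : Fin 3 → ℝ) : rotDer a (X 2) = C (a 0) * X 1 - C (a 1) * X 0 :=
  rotDer_X a 2

theorem rotDer_C (a : Fin 3 → ℝ) (c : ℝ) : rotDer a (C c) = 0 :=
  (rotDer a).map_algebraMap c

theorem rotDer_C_mul (a : Fin 3 → ℝ) (c : ℝ) (F : MvPolynomial (Fin 3) ℝ) :
    rotDer a (C c * F) = C c * rotDer a F := by
  rw [Derivation.leibniz, rotDer_C, smul_zero, add_zero, smul_eq_mul]

/-- The infinitesimal rotation about a coordinate axis. -/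
noncomputable abbrev axisDer (i : Fin 3) :
    Derivation ℝ (MvPolynomial (Fin 3) ℝ) (MvPolynomial (Fin 3) ℝ) :=
  rotDer (Pi.single i 1)

theorem rotDer_eq_sum (a : Fin 3 → ℝ) (F : MvPolynomial (Fin 3) ℝ) :
    rotDer a F = C (a 0) * axisDer 0 F + C (a 1) * axisDer 1 F + C (a 2) * axisDer 2 F := by
  have h : rotDer a = a 0 • axisDer 0 + a 1 • axisDer 1 + a 2 • axisDer 2 := by
    apply MvPolynomial.derivation_ext
    intro j
    fin_cases j <;>
      simp [rotDer_X_zero, rotDer_X_one, rotDer_X_two, smul_eq_C_mul] <;> ring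
  rw [h]
  simp [smul_eq_C_mul]

theorem hasDerivAt_eval_of_derivation
    (D : Derivation ℝ (MvPolynomial (Fin 3) ℝ) (MvPolynomial (Fin 3) ℝ))
    {γ : ℝ → Fin 3 → ℝ} {t : ℝ}
    (hγ : ∀ j, HasDerivAt (fun t => γ t j) (eval (γ t) (D (X j))) t)
    (F : MvPolynomial (Fin 3) ℝ) :
    HasDerivAt (fun t => eval (γ t) F) (eval (γ t) (D F)) t := by
  induction F using MvPolynomial.induction_on with
  | C a =>
    have : D (C a) = 0 := D.map_algebraMap a
    simpa [this] using hasDerivAt_const t a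
  | add p q hp hq =>
    simp only [map_add]
    exact hp.add hq
  | mul_X p j hp =>
    have := hp.mul (hγ j)
    simp only [map_mul, eval_X, Derivation.leibniz, smul_eq_mul, map_add]
    refine this.congr_deriv ?_
    ring

theorem hasDerivAt_eval_axisRotationFun (i : Fin 3) (x : Fin 3 → ℝ)
    (F : MvPolynomial (Fin 3) ℝ) (θ : ℝ) :
    HasDerivAt (fun θ => eval (axisRotationFun i θ x) F)
      (eval (axisRotationFun i θ x) (axisDer i F)) θ := by
  apply hasDerivAt_eval_of_derivation
  intro j
  have hc := Real.hasDerivAt_cos θ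
  have hs := Real.hasDerivAt_sin θ
  have h1 := (hc.mul_const (x (i + 1))).sub (hs.mul_const (x (i + 2)))
  have h2 := (hs.mul_const (x (i + 1))).add (hc.mul_const (x (i + 2)))
  fin_cases i <;> fin_cases j <;>
    simp [axisRotationFun, rotDer_X_zero, rotDer_X_one, rotDer_X_two] at h1 h2 ⊢ <;>
    first
    | exact hasDerivAt_const _ _
    | exact h1.congr_deriv (by ring)
    | exact h2.congr_deriv (by ring)

theorem sphereEval_axisRotation (i : Fin 3) (θ : ℝ) (p : UnitSphere2)
    (F : MvPolynomial (Fin 3) ℝ) :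
    sphereEval (sphereIsometry (axisRotation i θ) p) F =
      eval (axisRotationFun i θ fun j => (p : EuclideanSpace ℝ (Fin 3)) j) F := rfl

/-- Rotation orbits stay on the sphere, so an infinitesimal rotation depends only on the restriction
to it. This lets identities valid only on the sphere be differentiated. -/
theorem sphereEval_axisDer_eq_zero {F : MvPolynomial (Fin 3) ℝ}
    (hF : ∀ p, sphereEval p F = 0) (i : Fin 3) (p : UnitSphere2) :
    sphereEval p (axisDer i F) = 0 := by
  have h := hasDerivAt_eval_axisRotationFun i (fun j => (p : EuclideanSpace ℝ (Fin 3)) j) F 0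
  simp only [← sphereEval_axisRotation, hF] at h
  have := h.unique (hasDerivAt_const _ _)
  rwa [sphereEval_axisRotation, axisRotationFun_zero] at this

/-- The integral of the rotated polynomial does not depend on the angle; differentiate under the
integral sign at angle 0. -/
theorem integral_axisDer (i : Fin 3) (F : MvPolynomial (Fin 3) ℝ) :
    ∫ p, sphereEval p (axisDer i F) ∂sphereMeasure = 0 := by
  obtain ⟨M, hM⟩ := isCompact_univ.exists_bound_of_continuousOn
    (continuous_sphereEval (axisDer i F)).continuousOn
  have h := (hasDerivAt_integral_of_dominated_loc_of_deriv_le (μ := sphereMeasure) (𝕜 := ℝ)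
    (x₀ := 0) (s := Set.univ) (bound := fun _ => M)
    (F := fun θ p => sphereEval (sphereIsometry (axisRotation i θ) p) F)
    (F' := fun θ p => sphereEval (sphereIsometry (axisRotation i θ) p) (axisDer i F))
    Filter.univ_mem
    (Filter.Eventually.of_forall fun θ => ((continuous_sphereEval F).comp
      (continuous_sphereIsometry _)).aestronglyMeasurable)
    (integrable_sphere ((continuous_sphereEval F).comp (continuous_sphereIsometry _)))
    ((continuous_sphereEval _).comp (continuous_sphereIsometry _)).aestronglyMeasurable
    (Filter.Eventually.of_forall fun p θ _ => hM _ (Set.mem_univ _))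
    (integrable_const _)
    (Filter.Eventually.of_forall fun p θ _ => hasDerivAt_eval_axisRotationFun i _ F θ)).2
  have hc : ∀ G : MvPolynomial (Fin 3) ℝ, ∀ θ,
      ∫ p, sphereEval (sphereIsometry (axisRotation i θ) p) G ∂sphereMeasure =
        ∫ p, sphereEval p G ∂sphereMeasure := by
    intro G θ
    have hmp := measurePreserving_sphereIsometry (axisRotation i θ)
    have := integral_map (μ := sphereMeasure) hmp.measurable.aemeasurable
      (f := fun p => sphereEval p G) (continuous_sphereEval G).aestronglyMeasurable
    rw [← this, hmp.map_eq]
  simp only [hc] at h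
  exact h.unique (hasDerivAt_const _ _)

/-- Integral of a polynomial over the sphere. -/
noncomputable def sphereIntegral : MvPolynomial (Fin 3) ℝ →ₗ[ℝ] ℝ where
  toFun F := ∫ p, sphereEval p F ∂sphereMeasure
  map_add' F G := by
    simp only [map_add]
    exact integral_add (integrable_sphere (continuous_sphereEval F))
      (integrable_sphere (continuous_sphereEval G))
  map_smul' c F := by
    simp only [smul_eval, RingHom.id_apply, smul_eq_mul]
    exact integral_const_mul _ _

theorem sphereIntegral_apply (F : MvPolynomial (Fin 3) ℝ) :
    sphereIntegral F = ∫ p, sphereEval p F ∂sphereMeasure := rfl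

theorem sphereIntegral_C_mul (c : ℝ) (F : MvPolynomial (Fin 3) ℝ) :
    sphereIntegral (C c * F) = c * sphereIntegral F := by
  rw [← smul_eq_C_mul, map_smul, smul_eq_mul]

theorem sphereIntegral_congr {F G : MvPolynomial (Fin 3) ℝ}
    (h : ∀ p, sphereEval p F = sphereEval p G) : sphereIntegral F = sphereIntegral G := by
  simp only [sphereIntegral_apply, h]

theorem sphereIntegral_rotDer (a : Fin 3 → ℝ) (F : MvPolynomial (Fin 3) ℝ) :
    sphereIntegral (rotDer a F) = 0 := by
  have h : ∀ i, sphereIntegral (axisDer i F) = 0 := fun i => integral_axisDer i F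
  rw [rotDer_eq_sum, map_add, map_add]
  simp [sphereIntegral_C_mul, h]

theorem sphereIntegral_rotDer_mul (a : Fin 3 → ℝ) (F G : MvPolynomial (Fin 3) ℝ) :
    sphereIntegral (rotDer a F * G) = -sphereIntegral (F * rotDer a G) := by
  have h := sphereIntegral_rotDer a (F * G)
  rw [Derivation.leibniz, map_add, smul_eq_mul, smul_eq_mul, mul_comm G] at h
  linarith

theorem sphereMeasure_real_univ : sphereMeasure.real Set.univ = 4 * Real.pi := by
  rw [Measure.toSphere_real_apply_univ, measureReal_def, EuclideanSpace.volume_ball_fin_three]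
  have : 0 ≤ Real.pi * 4 / 3 := by positivity
  simp
  rw [ENNReal.toReal_ofReal this]
  ring

/-- The Casimir operator (the Laplace–Beltrami operator of the sphere). -/
noncomputable def sphereLaplacian (F : MvPolynomial (Fin 3) ℝ) : MvPolynomial (Fin 3) ℝ :=
  axisDer 0 (axisDer 0 F) + axisDer 1 (axisDer 1 F) + axisDer 2 (axisDer 2 F)

theorem sphereIntegral_sphereLaplacian_mul (F G : MvPolynomial (Fin 3) ℝ) :
    sphereIntegral (sphereLaplacian F * G) = sphereIntegral (F * sphereLaplacian G) := by
  have h : ∀ i, sphereIntegral (axisDer i (axisDer i F) * G) =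
      sphereIntegral (F * axisDer i (axisDer i G)) := fun i => by
    rw [sphereIntegral_rotDer_mul, sphereIntegral_rotDer_mul, neg_neg]
  simp only [sphereLaplacian, add_mul, mul_add, map_add, h]

theorem axisDer_commutator (F : MvPolynomial (Fin 3) ℝ) (i : Fin 3) :
    axisDer i (axisDer (i + 1) F) - axisDer (i + 1) (axisDer i F) = -axisDer (i + 2) F := by
  have h : ⁅axisDer i, axisDer (i + 1)⁆ = -axisDer (i + 2) := by
    apply MvPolynomial.derivation_ext
    intro j
    fin_cases i <;> fin_cases j <;>
      simp [axisDer, Derivation.commutator_apply, rotDer_X_zero, rotDer_X_one, rotDer_X_two]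
  have := congrArg (fun D => D F) h
  simpa [Derivation.commutator_apply] using this

/-- The Casimir element of so(3) is central. The hypotheses act as rewriting rules that bring every
word into the order D0, D1, D2, after which the two sides agree. -/
theorem sum_sq_commute_of_commutators
    {D0 D1 D2 : Derivation ℝ (MvPolynomial (Fin 3) ℝ) (MvPolynomial (Fin 3) ℝ)}
    (h0 : ∀ G, D1 (D0 G) = D0 (D1 G) + D2 G) (h1 : ∀ G, D2 (D1 G) = D1 (D2 G) + D0 G)
    (h2 : ∀ G, D2 (D0 G) = D0 (D2 G) - D1 G) (a b c : ℝ) (F : MvPolynomial (Fin 3) ℝ) :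
    D0 (D0 (C a * D0 F + C b * D1 F + C c * D2 F)) +
      D1 (D1 (C a * D0 F + C b * D1 F + C c * D2 F)) +
      D2 (D2 (C a * D0 F + C b * D1 F + C c * D2 F)) =
    C a * D0 (D0 (D0 F) + D1 (D1 F) + D2 (D2 F)) + C b * D1 (D0 (D0 F) + D1 (D1 F) + D2 (D2 F)) +
      C c * D2 (D0 (D0 F) + D1 (D1 F) + D2 (D2 F)) := by
  have hC : ∀ (D : Derivation ℝ (MvPolynomial (Fin 3) ℝ) (MvPolynomial (Fin 3) ℝ)) (r : ℝ) G,
      D (C r * G) = C r * D G := fun D r G => by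
    rw [← smul_eq_C_mul, Derivation.map_smul, smul_eq_C_mul]
  simp only [map_add, hC, h0, h1, h2, map_sub]
  ring

theorem sphereLaplacian_rotDer (a : Fin 3 → ℝ) (F : MvPolynomial (Fin 3) ℝ) :
    sphereLaplacian (rotDer a F) = rotDer a (sphereLaplacian F) := by
  have h0 : ∀ G, axisDer 1 (axisDer 0 G) = axisDer 0 (axisDer 1 G) + axisDer 2 G := fun G => by
    have := axisDer_commutator G 0
    simp only [zero_add] at this
    linear_combination -this
  have h1 : ∀ G, axisDer 2 (axisDer 1 G) = axisDer 1 (axisDer 2 G) + axisDer 0 G := fun G => by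
    have := axisDer_commutator G 1
    simp only [Fin.reduceAdd] at this
    linear_combination -this
  have h2 : ∀ G, axisDer 2 (axisDer 0 G) = axisDer 0 (axisDer 2 G) - axisDer 1 G := fun G => by
    have := axisDer_commutator G 2
    simp only [Fin.reduceAdd] at this
    linear_combination this
  rw [rotDer_eq_sum a, rotDer_eq_sum a]
  exact sum_sq_commute_of_commutators h0 h1 h2 _ _ _ F

/-- Eigenfunctions of the Laplacian of the sphere of degree `ℓ`, as polynomials. -/
def IsSphericalEigen (ℓ : ℕ) (F : MvPolynomial (Fin 3) ℝ) : Prop :=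
  ∀ p, sphereEval p (sphereLaplacian F) = -((ℓ : ℝ) * (ℓ + 1)) * sphereEval p F

/-- Rotations commute with the Laplacian. The eigenvalue equation holds only on the sphere, so it is
rotated as a polynomial vanishing there. -/
theorem IsSphericalEigen.rotDer {ℓ : ℕ} {F : MvPolynomial (Fin 3) ℝ} (hF : IsSphericalEigen ℓ F)
    (a : Fin 3 → ℝ) : IsSphericalEigen ℓ (rotDer a F) := by
  have h0 : ∀ p, sphereEval p (sphereLaplacian F + C ((ℓ : ℝ) * (ℓ + 1)) * F) = 0 := by
    intro p
    rw [map_add, map_mul, eval_C, hF p]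
    ring
  intro p
  have h := sphereEval_axisDer_eq_zero h0
  have e : sphereEval p (_root_.rotDer a (sphereLaplacian F + C ((ℓ : ℝ) * (ℓ + 1)) * F)) = 0 := by
    generalize sphereLaplacian F + C ((ℓ : ℝ) * (ℓ + 1)) * F = G at h
    rw [rotDer_eq_sum, map_add, map_add, map_mul, map_mul, map_mul, h, h, h]
    simp
  rw [map_add, rotDer_C_mul, ← sphereLaplacian_rotDer, map_add, map_mul, eval_C] at e
  linarith

/-! ### Zonal polynomials -/

/-- The linear form `x ↦ a · x`. -/
noncomputable def linForm (a : Fin 3 → ℝ) : MvPolynomial (Fin 3) ℝ :=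
  C (a 0) * X 0 + C (a 1) * X 1 + C (a 2) * X 2

/-- The polynomial `x ↦ f (a · x)`. -/
noncomputable def zonal (a : Fin 3 → ℝ) (f : Polynomial ℝ) : MvPolynomial (Fin 3) ℝ :=
  Polynomial.aeval (linForm a) f

theorem eval_linForm (a x : Fin 3 → ℝ) : eval x (linForm a) = a ⬝ᵥ x := by
  simp [linForm, dotProduct, Fin.sum_univ_three]

theorem eval_zonal (a x : Fin 3 → ℝ) (f : Polynomial ℝ) :
    eval x (zonal a f) = f.eval (a ⬝ᵥ x) := by
  rw [zonal, ← eval_linForm, Polynomial.aeval_def, Polynomial.hom_eval₂, Polynomial.eval,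
    Polynomial.eval₂_congr]
  · ext c; simp [algebraMap_eq]
  · rfl
  · rfl

theorem rotDer_linForm (a b : Fin 3 → ℝ) : rotDer b (linForm a) = linForm (crossProduct a b) := by
  simp only [linForm, map_add, rotDer_C_mul, rotDer_X_zero, rotDer_X_one, rotDer_X_two,
    cross_apply]
  simp
  ring

theorem rotDer_zonal (a b : Fin 3 → ℝ) (f : Polynomial ℝ) :
    rotDer b (zonal a f) = zonal a (Polynomial.derivative f) * linForm (crossProduct a b) := by
  rw [zonal, Derivation.map_aeval, rotDer_linForm, smul_eq_mul, zonal]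

/-- On profiles of zonal functions the spherical Laplacian acts as the Legendre operator. Unit
length of both a and x is needed, since the identity fails off the sphere. -/
theorem eval_sphereLaplacian_zonal {a x : Fin 3 → ℝ} (ha : a ⬝ᵥ a = 1) (hx : x ⬝ᵥ x = 1)
    (f : Polynomial ℝ) :
    eval x (sphereLaplacian (zonal a f)) = (legendreOp f).eval (a ⬝ᵥ x) := by
  simp only [sphereLaplacian, rotDer_zonal, Derivation.leibniz, rotDer_linForm, smul_eq_mul,
    legendreOp_apply, Polynomial.derivative_mul, map_add, map_mul, eval_zonal, eval_linForm,
    Polynomial.eval_add, Polynomial.eval_mul]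
  simp [dotProduct, Fin.sum_univ_three, cross_apply] at ha hx ⊢
  generalize Polynomial.eval _ (Polynomial.derivative f) = f1
  generalize Polynomial.eval _ (Polynomial.derivative (Polynomial.derivative f)) = f2
  linear_combination f2 * (x 0 ^ 2 + x 1 ^ 2 + x 2 ^ 2) * ha + f2 * hx

/-- The coordinate vector of a point of the sphere. -/
def UnitSphere2.vec (p : UnitSphere2) : Fin 3 → ℝ := fun i => (p : EuclideanSpace ℝ (Fin 3)) i

theorem UnitSphere2.vec_dot_self (p : UnitSphere2) : p.vec ⬝ᵥ p.vec = 1 := by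
  have := p.sum_sq
  simp [dotProduct, Fin.sum_univ_three, UnitSphere2.vec]
  linarith

theorem sphereEval_zonal (a : Fin 3 → ℝ) (p : UnitSphere2) (f : Polynomial ℝ) :
    sphereEval p (zonal a f) = f.eval (a ⬝ᵥ p.vec) :=
  eval_zonal a _ f

theorem isSphericalEigen_zonal (q : UnitSphere2) (ℓ : ℕ) :
    IsSphericalEigen ℓ (zonal q.vec (legendreP ℓ)) := by
  intro p
  refine (eval_sphereLaplacian_zonal q.vec_dot_self p.vec_dot_self _).trans ?_
  rw [legendreOp_legendreP, sphereEval_zonal]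
  simp

/-- Pairing of zonal polynomials of pole `a` with a polynomial, as a functional on profiles. -/
noncomputable def zonalPairing (a : Fin 3 → ℝ) (F : MvPolynomial (Fin 3) ℝ) :
    Polynomial ℝ →ₗ[ℝ] ℝ :=
  sphereIntegral ∘ₗ LinearMap.mulRight ℝ F ∘ₗ (Polynomial.aeval (linForm a)).toLinearMap

theorem zonalPairing_apply (a : Fin 3 → ℝ) (F : MvPolynomial (Fin 3) ℝ) (f : Polynomial ℝ) :
    zonalPairing a F f = sphereIntegral (zonal a f * F) := rfl

/-- The Legendre operator on the profile is the Laplacian on the zonal function, which by symmetry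
passes to F and produces its eigenvalue. This brings zonal pairings within reach of
`exists_legendre_multiple`. -/
theorem zonalPairing_legendreOp_add {ℓ : ℕ} {F : MvPolynomial (Fin 3) ℝ}
    (hF : IsSphericalEigen ℓ F) (p : UnitSphere2) (g : Polynomial ℝ) :
    zonalPairing p.vec F (legendreOp g + Polynomial.C ((ℓ : ℝ) * (ℓ + 1)) * g) = 0 := by
  have h1 : sphereIntegral (zonal p.vec (legendreOp g) * F) =
      sphereIntegral (sphereLaplacian (zonal p.vec g) * F) := by
    refine sphereIntegral_congr fun q => ?_
    rw [map_mul, map_mul, sphereEval_zonal]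
    congr 1
    exact (eval_sphereLaplacian_zonal p.vec_dot_self q.vec_dot_self g).symm
  have h2 : sphereIntegral (zonal p.vec g * sphereLaplacian F) =
      sphereIntegral (C (-((ℓ : ℝ) * (ℓ + 1))) * (zonal p.vec g * F)) := by
    refine sphereIntegral_congr fun q => ?_
    rw [map_mul, map_mul, map_mul, hF q, eval_C]
    ring
  rw [map_add, ← Polynomial.smul_eq_C_mul, map_smul, zonalPairing_apply, zonalPairing_apply, h1,
    sphereIntegral_sphereLaplacian_mul, h2, sphereIntegral_C_mul, smul_eq_mul]
  ring

end SphereCalculus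

/-! ### The Funk–Hecke formula -/

section FunkHecke

open MvPolynomial

theorem legendreP_zero : legendreP 0 = 1 := by simp [legendreP]

theorem isSphericalEigen_one : IsSphericalEigen 0 1 := by
  intro p
  simp [sphereLaplacian]

theorem zonal_one (a : Fin 3 → ℝ) : zonal a 1 = 1 := map_one _

theorem sphereIntegral_one : sphereIntegral 1 = 4 * Real.pi := by
  rw [sphereIntegral_apply]
  simp only [map_one, integral_const, smul_eq_mul, mul_one]
  exact sphereMeasure_real_univ

/-- Both sides annihilate the range of the Legendre operator, hence are proportional. The profile 1
fixes the ratio as 4π to 2. -/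
theorem sphereIntegral_zonal (p : UnitSphere2) (f : Polynomial ℝ) :
    sphereIntegral (zonal p.vec f) = 2 * Real.pi * integralPoly f := by
  obtain ⟨c, h1, h2, -⟩ := integralPoly_mul_legendreP 0 f
  have h := h1 _ (zonalPairing_legendreOp_add isSphericalEigen_one p)
  rw [zonalPairing_apply, zonalPairing_apply, legendreP_zero, zonal_one, mul_one, mul_one,
    sphereIntegral_one] at h
  rw [integralPoly_legendreP_sq, legendreP_zero, mul_one] at h2
  rw [h, h2]
  norm_num
  ring

/-! ### Concentration of zonal profiles at the pole. -/

theorem UnitSphere2.abs_dot_le_one (p q : UnitSphere2) : p.vec ⬝ᵥ q.vec ∈ Set.Icc (-1 : ℝ) 1 := by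
  have h1 := p.vec_dot_self
  have h2 := q.vec_dot_self
  simp only [dotProduct, Fin.sum_univ_three] at *
  constructor <;> nlinarith [sq_nonneg (p.vec 0 - q.vec 0), sq_nonneg (p.vec 1 - q.vec 1),
    sq_nonneg (p.vec 2 - q.vec 2), sq_nonneg (p.vec 0 + q.vec 0), sq_nonneg (p.vec 1 + q.vec 1),
    sq_nonneg (p.vec 2 + q.vec 2)]

theorem UnitSphere2.dist_sq (p q : UnitSphere2) : dist q p ^ 2 = 2 * (1 - p.vec ⬝ᵥ q.vec) := by
  have h1 := p.vec_dot_self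
  have h2 := q.vec_dot_self
  rw [Subtype.dist_eq, EuclideanSpace.dist_eq, Real.sq_sqrt (by positivity), Fin.sum_univ_three]
  simp only [dotProduct, Fin.sum_univ_three, Real.dist_eq, sq_abs, UnitSphere2.vec] at *
  linarith

/-- Close to p continuity gives ε. At distance at least δ one has 1 - p · q ≥ δ²/2, so a multiple of
it dominates the global bound. -/
theorem exists_abs_sub_le_sphere {φ : UnitSphere2 → ℝ} (hφ : Continuous φ) (p : UnitSphere2)
    {ε : ℝ} (hε : 0 < ε) :
    ∃ M, ∀ q, |φ q - φ p| ≤ ε + M * (1 - p.vec ⬝ᵥ q.vec) := by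
  obtain ⟨B, hB⟩ := isCompact_univ.exists_bound_of_continuousOn
    (f := fun q => φ q - φ p) (by fun_prop)
  obtain ⟨δ, hδ, h⟩ := Metric.continuous_iff.mp hφ p ε hε
  have hB0 : 0 ≤ B := (norm_nonneg _).trans (hB p (Set.mem_univ _))
  refine ⟨2 * B / δ ^ 2, fun q => ?_⟩
  have hd := p.dist_sq q
  rcases lt_or_ge (dist q p) δ with hq | hq
  · have h1 := h q hq
    rw [Real.dist_eq] at h1
    have : 0 ≤ 2 * B / δ ^ 2 * (1 - p.vec ⬝ᵥ q.vec) := by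
      have := (p.abs_dot_le_one q).2
      exact mul_nonneg (by positivity) (by linarith)
    linarith
  · have h1 : δ ^ 2 ≤ dist q p ^ 2 := by gcongr
    have h2 := hB q (Set.mem_univ _)
    rw [Real.norm_eq_abs] at h2
    have h3 : B ≤ 2 * B / δ ^ 2 * (1 - p.vec ⬝ᵥ q.vec) := by
      rw [div_mul_eq_mul_div, le_div_iff₀ (by positivity)]
      nlinarith
    linarith

theorem integralPoly_one_add_X_pow (n : ℕ) :
    integralPoly ((1 + Polynomial.X) ^ n) = 2 ^ (n + 1) / (n + 1) := by
  have h := integralPoly_derivative ((1 + Polynomial.X) ^ (n + 1))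
  have e : Polynomial.derivative ((1 + Polynomial.X : Polynomial ℝ) ^ (n + 1)) =
      Polynomial.C ((n : ℝ) + 1) * (1 + Polynomial.X) ^ n := by
    simp [Polynomial.derivative_pow]
  rw [e, integralPoly_C_mul] at h
  simp at h
  rw [eq_div_iff (by positivity), mul_comm, h]
  norm_num

theorem integralPoly_one_add_X_pow_mul (n : ℕ) :
    integralPoly ((1 + Polynomial.X) ^ n * (1 - Polynomial.X)) =
      integralPoly ((1 + Polynomial.X) ^ n) * (2 / (n + 2)) := by
  have e : (1 + Polynomial.X : Polynomial ℝ) ^ n * (1 - Polynomial.X) =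
      Polynomial.C 2 * (1 + Polynomial.X) ^ n - (1 + Polynomial.X) ^ (n + 1) := by
    rw [pow_succ, map_ofNat]; ring
  rw [e, map_sub, integralPoly_C_mul, integralPoly_one_add_X_pow, integralPoly_one_add_X_pow]
  push_cast
  field_simp
  ring

theorem abs_integralPoly_le {f g : Polynomial ℝ}
    (h : ∀ t ∈ Set.Icc (-1 : ℝ) 1, |f.eval t| ≤ g.eval t) : |integralPoly f| ≤ integralPoly g := by
  rw [abs_le, ← map_neg]
  exact ⟨integralPoly_mono fun t ht => by
      rw [Polynomial.eval_neg]; exact (abs_le.mp (h t ht)).1,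
    integralPoly_mono fun t ht => (abs_le.mp (h t ht)).2⟩

/-- A polynomial whose pairings with profiles concentrated at `1` are controlled vanishes
at `1`. -/
theorem eval_one_eq_zero_of_concentrated {r : Polynomial ℝ}
    (h : ∀ ε > 0, ∃ M, ∀ n : ℕ, |integralPoly ((1 + Polynomial.X) ^ n * r)| ≤
      integralPoly ((1 + Polynomial.X) ^ n * (Polynomial.C ε + Polynomial.C M *
        (1 - Polynomial.X)))) : r.eval 1 = 0 := by
  obtain ⟨s, hs⟩ : ∃ s, r = Polynomial.C (r.eval 1) + (1 - Polynomial.X) * s := by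
    obtain ⟨s, hs⟩ := Polynomial.X_sub_C_dvd_sub_C_eval (a := (1 : ℝ)) (p := r)
    refine ⟨-s, ?_⟩
    rw [map_one] at hs
    linear_combination hs
  obtain ⟨M', hM'⟩ := (isCompact_Icc (a := (-1 : ℝ)) (b := 1)).exists_bound_of_continuousOn
    s.continuous.continuousOn
  refine abs_eq_zero.mp (le_antisymm (le_of_forall_pos_le_add fun ε hε => ?_) (abs_nonneg _))
  obtain ⟨M, hM⟩ := h ε hε
  -- The weights (1+t)^n concentrate at t = 1: against them 1-t has mean 2/(n+2), so every error
  -- term except ε disappears in the limit.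
  have key : ∀ n : ℕ, |r.eval 1| ≤ ε + (M + M') * (2 / ((n : ℝ) + 2)) := by
    intro n
    have hA : 0 < integralPoly ((1 + Polynomial.X) ^ n) := by
      rw [integralPoly_one_add_X_pow]; positivity
    have h1 := hM n
    have h2 : |integralPoly ((1 + Polynomial.X) ^ n * (1 - Polynomial.X) * s)| ≤
        integralPoly (Polynomial.C M' * ((1 + Polynomial.X) ^ n * (1 - Polynomial.X))) := by
      refine abs_integralPoly_le fun t ht => ?_
      have ha : 0 ≤ (1 + t) ^ n * (1 - t) :=
        mul_nonneg (pow_nonneg (by linarith [ht.1]) _) (by linarith [ht.2])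
      have := hM' t ht
      rw [Real.norm_eq_abs] at this
      simp only [Polynomial.eval_mul, Polynomial.eval_pow, Polynomial.eval_add,
        Polynomial.eval_sub, Polynomial.eval_one, Polynomial.eval_X, Polynomial.eval_C]
      rw [abs_mul, abs_of_nonneg ha, mul_comm]
      gcongr
    have e1 : integralPoly ((1 + Polynomial.X) ^ n * r) =
        r.eval 1 * integralPoly ((1 + Polynomial.X) ^ n) +
          integralPoly ((1 + Polynomial.X) ^ n * (1 - Polynomial.X) * s) := by
      rw [← integralPoly_C_mul, ← map_add]
      congr 1
      conv_lhs => rw [hs]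
      ring
    have e2 : integralPoly ((1 + Polynomial.X) ^ n * (Polynomial.C ε + Polynomial.C M *
        (1 - Polynomial.X))) = ε * integralPoly ((1 + Polynomial.X) ^ n) +
        M * integralPoly ((1 + Polynomial.X) ^ n * (1 - Polynomial.X)) := by
      rw [← integralPoly_C_mul, ← integralPoly_C_mul, ← map_add]
      congr 1
      ring
    rw [integralPoly_C_mul, integralPoly_one_add_X_pow_mul] at h2
    rw [e2, integralPoly_one_add_X_pow_mul] at h1
    refine le_of_mul_le_mul_right (a := integralPoly ((1 + Polynomial.X) ^ n)) ?_ hA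
    have e3 : |r.eval 1| * integralPoly ((1 + Polynomial.X) ^ n) =
        |integralPoly ((1 + Polynomial.X) ^ n * r) -
          integralPoly ((1 + Polynomial.X) ^ n * (1 - Polynomial.X) * s)| := by
      rw [e1, add_sub_cancel_right, abs_mul, abs_of_pos hA]
    rw [e3]
    refine (abs_sub _ _).trans ?_
    linarith
  have hlim : Filter.Tendsto (fun n : ℕ => ε + (M + M') * (2 / ((n : ℝ) + 2))) Filter.atTop
      (nhds (ε + (M + M') * 0)) := by
    refine Filter.Tendsto.const_add _ (Filter.Tendsto.const_mul _ ?_)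
    exact Filter.Tendsto.div_atTop tendsto_const_nhds
      (Filter.tendsto_atTop_add_const_right _ _ tendsto_natCast_atTop_atTop)
  have := ge_of_tendsto' hlim key
  linarith

/-- The Funk–Hecke formula. -/
theorem funkHecke {ℓ : ℕ} {F : MvPolynomial (Fin 3) ℝ} (hF : IsSphericalEigen ℓ F)
    (p : UnitSphere2) (f : Polynomial ℝ) :
    sphereIntegral (zonal p.vec f * F) =
      2 * Real.pi * sphereEval p F * integralPoly (f * legendreP ℓ) := by
  set N := integralPoly (legendreP ℓ * legendreP ℓ) with hN
  have hN0 : N ≠ 0 := by rw [hN, integralPoly_legendreP_sq]; positivity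
  set a := zonalPairing p.vec F (legendreP ℓ) / N with ha
  -- Proportionality of the two functionals gives the formula with an unknown factor a independent
  -- of f.
  have hall : ∀ f, sphereIntegral (zonal p.vec f * F) = a * integralPoly (f * legendreP ℓ) := by
    intro f
    obtain ⟨c, h1, h2, -⟩ := integralPoly_mul_legendreP ℓ f
    have h := h1 _ (zonalPairing_legendreOp_add hF p)
    rw [zonalPairing_apply] at h
    rw [h, h2, ha, ← hN]
    field_simp
  -- The factor is identified as 2π F(p) by testing with profiles concentrated at p, where F may be
  -- replaced by its value F(p).
  have hr : (Polynomial.C a * legendreP ℓ -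
      Polynomial.C (2 * Real.pi * sphereEval p F)).eval 1 = 0 := by
    refine eval_one_eq_zero_of_concentrated fun ε hε => ?_
    have hpi := Real.pi_pos
    obtain ⟨M, hM⟩ := exists_abs_sub_le_sphere (continuous_sphereEval F) p
      (ε := ε / (2 * Real.pi)) (by positivity)
    refine ⟨2 * Real.pi * M, fun n => ?_⟩
    set φ : Polynomial ℝ := (1 + Polynomial.X) ^ n with hφ
    have e1 : integralPoly (φ * (Polynomial.C a * legendreP ℓ -
        Polynomial.C (2 * Real.pi * sphereEval p F))) =
        sphereIntegral (zonal p.vec φ * (F - C (sphereEval p F))) := by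
      rw [mul_sub, mul_sub, map_sub, map_sub, hall, mul_left_comm, integralPoly_C_mul,
        mul_comm φ (Polynomial.C _), integralPoly_C_mul, mul_comm (zonal _ _) (C _), sphereIntegral_C_mul,
        sphereIntegral_zonal]
      ring
    have e2 : integralPoly (φ * (Polynomial.C ε + Polynomial.C (2 * Real.pi * M) *
        (1 - Polynomial.X))) = sphereIntegral (zonal p.vec (φ *
          (Polynomial.C (ε / (2 * Real.pi)) + Polynomial.C M * (1 - Polynomial.X)))) := by
      rw [sphereIntegral_zonal, ← integralPoly_C_mul]
      congr 1
      have : ε = 2 * Real.pi * (ε / (2 * Real.pi)) := by field_simp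
      conv_lhs => rw [this]
      simp only [map_mul]
      ring
    rw [e1, e2, sphereIntegral_apply, sphereIntegral_apply]
    refine (abs_integral_le_integral_abs).trans (integral_mono
      (integrable_sphere (continuous_sphereEval _).abs)
      (integrable_sphere (continuous_sphereEval _)) fun q => ?_)
    have hq := p.abs_dot_le_one q
    simp only [map_mul, map_sub, sphereEval_zonal, eval_C, Polynomial.eval_mul,
      Polynomial.eval_add, Polynomial.eval_sub, Polynomial.eval_one, Polynomial.eval_C,
      Polynomial.eval_X]
    have hpos : 0 ≤ φ.eval (p.vec ⬝ᵥ q.vec) := by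
      simp only [hφ, Polynomial.eval_pow, Polynomial.eval_add, Polynomial.eval_one,
        Polynomial.eval_X]
      exact pow_nonneg (by linarith [hq.1]) _
    rw [abs_mul, abs_of_nonneg hpos]
    exact mul_le_mul_of_nonneg_left (hM q) hpos
  rw [Polynomial.eval_sub, Polynomial.eval_mul, Polynomial.eval_C, Polynomial.eval_C,
    legendreP_eval_one, mul_one, sub_eq_zero] at hr
  rw [hall, hr]

/-- The profile of the reproducing kernel of the spherical harmonics of degree `ℓ`. -/
noncomputable def zonalKernel (ℓ : ℕ) : Polynomial ℝ :=
  Polynomial.C ((2 * ℓ + 1) / (4 * Real.pi)) * legendreP ℓ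

theorem IsSphericalEigen.C_mul {ℓ : ℕ} {F : MvPolynomial (Fin 3) ℝ} (hF : IsSphericalEigen ℓ F)
    (c : ℝ) : IsSphericalEigen ℓ (C c * F) := by
  intro p
  have h : sphereLaplacian (C c * F) = C c * sphereLaplacian F := by
    simp only [sphereLaplacian, rotDer_C_mul]
    ring
  rw [h, map_mul, map_mul, hF p]
  ring

theorem zonal_zonalKernel (a : Fin 3 → ℝ) (ℓ : ℕ) :
    zonal a (zonalKernel ℓ) = C ((2 * ℓ + 1) / (4 * Real.pi)) * zonal a (legendreP ℓ) := by
  rw [zonalKernel, zonal, map_mul, Polynomial.aeval_C]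
  rfl

theorem isSphericalEigen_zonalKernel (q : UnitSphere2) (ℓ : ℕ) :
    IsSphericalEigen ℓ (zonal q.vec (zonalKernel ℓ)) := by
  rw [zonal_zonalKernel]
  exact (isSphericalEigen_zonal q ℓ).C_mul _

theorem sphereIntegral_zonalKernel_mul {ℓ : ℕ} {F : MvPolynomial (Fin 3) ℝ}
    (hF : IsSphericalEigen ℓ F) (p : UnitSphere2) :
    sphereIntegral (zonal p.vec (zonalKernel ℓ) * F) = sphereEval p F := by
  have hpi := Real.pi_pos
  rw [funkHecke hF, zonalKernel, mul_assoc (Polynomial.C _), integralPoly_C_mul,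
    integralPoly_legendreP_sq]
  field_simp
  ring

end FunkHecke

/-! ### Iterated integrals over the sphere -/

section SphereFubini

theorem continuous_sphere_integral {X : Type*} [TopologicalSpace X] [FirstCountableTopology X]
    [LocallyCompactSpace X] {Φ : X → UnitSphere2 → ℝ}
    (h : Continuous fun z : X × UnitSphere2 => Φ z.1 z.2) :
    Continuous fun x => ∫ q, Φ x q ∂sphereMeasure := by
  have := continuous_parametric_integral_of_continuous (μ := sphereMeasure) (f := Φ) h
    isCompact_univ
  simpa using this

theorem integral_sphere_swap {Φ : UnitSphere2 → UnitSphere2 → ℝ}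
    (h : Continuous fun z : UnitSphere2 × UnitSphere2 => Φ z.1 z.2) :
    ∫ p, ∫ q, Φ p q ∂sphereMeasure ∂sphereMeasure =
      ∫ q, ∫ p, Φ p q ∂sphereMeasure ∂sphereMeasure :=
  integral_integral_swap
    (h.integrable_of_hasCompactSupport (HasCompactSupport.of_compactSpace _))

/-- Each pair of integrals becomes one integral over the product of two spheres; Fubini is then
applied once. -/
theorem integral_sphere_swap_pairs
    {Φ : UnitSphere2 → UnitSphere2 → UnitSphere2 → UnitSphere2 → ℝ}
    (h : Continuous fun z : (UnitSphere2 × UnitSphere2) × (UnitSphere2 × UnitSphere2) =>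
      Φ z.1.1 z.1.2 z.2.1 z.2.2) :
    ∫ a, ∫ b, ∫ c, ∫ d, Φ a b c d
      ∂sphereMeasure ∂sphereMeasure ∂sphereMeasure ∂sphereMeasure =
    ∫ c, ∫ d, ∫ a, ∫ b, Φ a b c d
      ∂sphereMeasure ∂sphereMeasure ∂sphereMeasure ∂sphereMeasure := by
  have hint : ∀ {Y : Type} [TopologicalSpace Y] [CompactSpace Y] [MeasurableSpace Y]
      [OpensMeasurableSpace Y] (ν : Measure Y) [IsFiniteMeasure ν] {g : Y → ℝ},
      Continuous g → Integrable g ν := fun ν _ g hg =>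
    hg.integrable_of_hasCompactSupport (HasCompactSupport.of_compactSpace _)
  have hin : ∀ {Ψ : UnitSphere2 → UnitSphere2 → ℝ},
      Continuous (fun z : UnitSphere2 × UnitSphere2 => Ψ z.1 z.2) →
      ∫ a, ∫ b, Ψ a b ∂sphereMeasure ∂sphereMeasure =
        ∫ z, Ψ z.1 z.2 ∂(sphereMeasure.prod sphereMeasure) := fun {Ψ} hΨ =>
    (integral_prod (fun z : UnitSphere2 × UnitSphere2 => Ψ z.1 z.2) (hint _ hΨ)).symm
  have hpar : ∀ {Ψ : (UnitSphere2 × UnitSphere2) → (UnitSphere2 × UnitSphere2) → ℝ},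
      Continuous (fun z : (UnitSphere2 × UnitSphere2) × (UnitSphere2 × UnitSphere2) =>
        Ψ z.1 z.2) →
      Continuous fun x => ∫ y, Ψ x y ∂(sphereMeasure.prod sphereMeasure) := fun {Ψ} hΨ => by
    have := continuous_parametric_integral_of_continuous
      (μ := sphereMeasure.prod sphereMeasure) (f := Ψ) hΨ isCompact_univ
    simpa using this
  have h' : Continuous fun z : (UnitSphere2 × UnitSphere2) × (UnitSphere2 × UnitSphere2) =>
      Φ z.2.1 z.2.2 z.1.1 z.1.2 := h.comp continuous_swap
  have e1 : ∀ a b, ∫ c, ∫ d, Φ a b c d ∂sphereMeasure ∂sphereMeasure =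
      ∫ y, Φ a b y.1 y.2 ∂(sphereMeasure.prod sphereMeasure) := fun a b =>
    hin (h.comp (by fun_prop : Continuous fun y : UnitSphere2 × UnitSphere2 => ((a, b), y)))
  have e2 : ∀ c d, ∫ a, ∫ b, Φ a b c d ∂sphereMeasure ∂sphereMeasure =
      ∫ x, Φ x.1 x.2 c d ∂(sphereMeasure.prod sphereMeasure) := fun c d =>
    hin (Ψ := fun a b => Φ a b c d)
      (h.comp (by fun_prop : Continuous fun x : UnitSphere2 × UnitSphere2 => (x, (c, d))))
  simp only [e1, e2]
  rw [hin (Ψ := fun a b => ∫ y, Φ a b y.1 y.2 ∂(sphereMeasure.prod sphereMeasure))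
      (hpar (Ψ := fun x y => Φ x.1 x.2 y.1 y.2) h),
    hin (Ψ := fun c d => ∫ x, Φ x.1 x.2 c d ∂(sphereMeasure.prod sphereMeasure))
      (hpar (Ψ := fun y x => Φ x.1 x.2 y.1 y.2) h')]
  exact integral_integral_swap (f := fun x y : UnitSphere2 × UnitSphere2 => Φ x.1 x.2 y.1 y.2)
    (hint _ h)

/-- Cauchy–Schwarz, from the discriminant of the nonnegative quadratic t ↦ ∫ (tf + g)². -/
theorem integral_sphere_mul_sq_le {f g : UnitSphere2 → ℝ} (hf : Continuous f)
    (hg : Continuous g) :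
    (∫ p, f p * g p ∂sphereMeasure) ^ 2 ≤
      (∫ p, f p ^ 2 ∂sphereMeasure) * ∫ p, g p ^ 2 ∂sphereMeasure := by
  have h : ∀ t : ℝ, 0 ≤ (∫ p, f p ^ 2 ∂sphereMeasure) * (t * t) +
      (2 * ∫ p, f p * g p ∂sphereMeasure) * t + ∫ p, g p ^ 2 ∂sphereMeasure := by
    intro t
    have h0 : 0 ≤ ∫ p, (f p * t + g p) ^ 2 ∂sphereMeasure :=
      integral_nonneg fun p => sq_nonneg _
    have e : ∫ p, (f p * t + g p) ^ 2 ∂sphereMeasure = ∫ p, (t * t * f p ^ 2 +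
        2 * t * (f p * g p) + g p ^ 2) ∂sphereMeasure := by
      congr 1; ext p; ring
    rw [e, integral_add (integrable_sphere (by fun_prop)) (integrable_sphere (by fun_prop)),
      integral_add (integrable_sphere (by fun_prop)) (integrable_sphere (by fun_prop)),
      integral_const_mul, integral_const_mul] at h0
    linarith
  have := discrim_le_zero h
  rw [discrim] at this
  nlinarith

end SphereFubini

/-! ### The Poisson bracket on polynomials -/

section PolyBracket

open MvPolynomial

/-- The Poisson bracket of the sphere on polynomials, `X · (∇F × ∇G)`. -/
noncomputable def polyBracket (F G : MvPolynomial (Fin 3) ℝ) : MvPolynomial (Fin 3) ℝ :=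
  X 0 * (pderiv 1 F * pderiv 2 G - pderiv 2 F * pderiv 1 G) +
  X 1 * (pderiv 2 F * pderiv 0 G - pderiv 0 F * pderiv 2 G) +
  X 2 * (pderiv 0 F * pderiv 1 G - pderiv 1 F * pderiv 0 G)

theorem rotDer_eq_pderiv (a : Fin 3 → ℝ) (F : MvPolynomial (Fin 3) ℝ) :
    rotDer a F = (C (a 1) * X 2 - C (a 2) * X 1) * pderiv 0 F +
      (C (a 2) * X 0 - C (a 0) * X 2) * pderiv 1 F +
      (C (a 0) * X 1 - C (a 1) * X 0) * pderiv 2 F := by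
  have h : rotDer a = (C (a 1) * X 2 - C (a 2) * X 1 : MvPolynomial (Fin 3) ℝ) • pderiv 0 +
      (C (a 2) * X 0 - C (a 0) * X 2 : MvPolynomial (Fin 3) ℝ) • pderiv 1 +
      (C (a 0) * X 1 - C (a 1) * X 0 : MvPolynomial (Fin 3) ℝ) • pderiv 2 := by
    apply MvPolynomial.derivation_ext
    intro j
    fin_cases j <;>
      simp [rotDer_X_zero, rotDer_X_one, rotDer_X_two, pderiv_X]
  rw [h]
  simp

theorem polyBracket_antisymm (F G : MvPolynomial (Fin 3) ℝ) :
    polyBracket F G = -polyBracket G F := by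
  simp only [polyBracket]; ring

theorem polyBracket_mul_right (F G H : MvPolynomial (Fin 3) ℝ) :
    polyBracket F (G * H) = polyBracket F G * H + G * polyBracket F H := by
  simp only [polyBracket, Derivation.leibniz, smul_eq_mul]; ring

theorem pderiv_comm (i j : Fin 3) (F : MvPolynomial (Fin 3) ℝ) :
    pderiv i (pderiv j F) = pderiv j (pderiv i F) := by
  have h : ⁅(pderiv i : Derivation ℝ (MvPolynomial (Fin 3) ℝ) (MvPolynomial (Fin 3) ℝ)),
      (pderiv j : Derivation ℝ (MvPolynomial (Fin 3) ℝ) (MvPolynomial (Fin 3) ℝ))⁆ = 0 := by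
    apply MvPolynomial.derivation_ext
    intro k
    simp only [Derivation.commutator_apply, pderiv_X, Derivation.coe_zero, Pi.zero_apply]
    rcases eq_or_ne k i with rfl | h1 <;> rcases eq_or_ne k j with rfl | h2 <;>
      simp [*]
  have := congrArg (fun D => D F) h
  simp only [Derivation.commutator_apply, Derivation.coe_zero, Pi.zero_apply] at this
  exact sub_eq_zero.mp this

/-- The bracket is minus the sum over i of the i-th infinitesimal rotation of ∂_i F · G: the
second-order terms cancel by symmetry of mixed derivatives. Every rotation derivative integrates to
zero. -/
theorem sphereIntegral_polyBracket (F G : MvPolynomial (Fin 3) ℝ) :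
    sphereIntegral (polyBracket F G) = 0 := by
  have e : polyBracket F G = -(axisDer 0 (pderiv 0 F * G) + axisDer 1 (pderiv 1 F * G) +
      axisDer 2 (pderiv 2 F * G)) := by
    simp only [rotDer_eq_pderiv, polyBracket, Derivation.leibniz, smul_eq_mul]
    simp
    rw [pderiv_comm 1 0, pderiv_comm 2 0, pderiv_comm 2 1]
    ring
  rw [e, map_neg, map_add, map_add, sphereIntegral_rotDer, sphereIntegral_rotDer,
    sphereIntegral_rotDer]
  simp

/-- Expand ∫ {G, FH} = 0 by the Leibniz rule. The resulting cyclic symmetry frees F from derivatives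
and later moves the largest degree into the last slot. -/
theorem sphereIntegral_polyBracket_mul (F G H : MvPolynomial (Fin 3) ℝ) :
    sphereIntegral (polyBracket F G * H) = sphereIntegral (polyBracket G H * F) := by
  have h := sphereIntegral_polyBracket G (F * H)
  rw [polyBracket_mul_right, map_add, polyBracket_antisymm G F, neg_mul, map_neg,
    mul_comm F] at h
  linarith

theorem polyBracket_zonal (F : MvPolynomial (Fin 3) ℝ) (a : Fin 3 → ℝ) (g : Polynomial ℝ) :
    polyBracket F (zonal a g) = zonal a (Polynomial.derivative g) * rotDer a F := by
  have h : ∀ i, pderiv i (zonal a g) = zonal a (Polynomial.derivative g) * C (a i) := by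
    intro i
    rw [zonal, Derivation.map_aeval, smul_eq_mul, ← zonal]
    congr 1
    simp only [linForm, map_add, pderiv_C_mul, pderiv_X]
    fin_cases i <;> simp
  rw [polyBracket, h, h, h, rotDer_eq_pderiv]
  ring

end PolyBracket

/-! ### The Hilbert–Schmidt bound -/

section HilbertSchmidt

open MvPolynomial

theorem continuous_vec_apply (i : Fin 3) : Continuous fun p : UnitSphere2 => p.vec i :=
  continuous_sphere_coord i

/-- The kernel of the Poisson bracket of two zonal functions with poles `q` and `q'`. -/
noncomputable def bracketKernel (f g : Polynomial ℝ) (p q q' : UnitSphere2) : ℝ :=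
  (Polynomial.derivative f).eval (q.vec ⬝ᵥ p.vec) *
    (Polynomial.derivative g).eval (q'.vec ⬝ᵥ p.vec) * (crossProduct q.vec q'.vec ⬝ᵥ p.vec)

theorem sphereEval_polyBracket_zonal (f g : Polynomial ℝ) (p q q' : UnitSphere2) :
    sphereEval p (polyBracket (zonal q.vec f) (zonal q'.vec g)) = bracketKernel f g p q q' := by
  rw [polyBracket_zonal, rotDer_zonal, map_mul, map_mul, sphereEval_zonal, sphereEval_zonal,
    bracketKernel]
  have : sphereEval p (linForm (crossProduct q.vec q'.vec)) =
    crossProduct q.vec q'.vec ⬝ᵥ p.vec := eval_linForm _ _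
  rw [this]
  ring

theorem continuous_bracketKernel (f g : Polynomial ℝ) {Z : Type*} [TopologicalSpace Z]
    {a b c : Z → UnitSphere2} (ha : Continuous a) (hb : Continuous b) (hc : Continuous c) :
    Continuous fun z => bracketKernel f g (a z) (b z) (c z) := by
  have ha' : ∀ i, Continuous fun z => (a z).vec i := fun i => (continuous_vec_apply i).comp ha
  have hb' : ∀ i, Continuous fun z => (b z).vec i := fun i => (continuous_vec_apply i).comp hb
  have hc' : ∀ i, Continuous fun z => (c z).vec i := fun i => (continuous_vec_apply i).comp hc
  simp only [bracketKernel, dotProduct, Fin.sum_univ_three, cross_apply]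
  simp
  fun_prop

/-- Insert the reproducing formula for F, exchange the integrals and use the symmetry of the kernel.
-/
theorem sphereIntegral_mul_eq_of_eigen {ℓ : ℕ} {F : MvPolynomial (Fin 3) ℝ}
    (hF : IsSphericalEigen ℓ F) (W : MvPolynomial (Fin 3) ℝ) :
    sphereIntegral (F * W) =
      ∫ q, sphereEval q F * sphereIntegral (zonal q.vec (zonalKernel ℓ) * W) ∂sphereMeasure := by
  have hc : Continuous fun z : UnitSphere2 × UnitSphere2 =>
      (zonalKernel ℓ).eval (z.1.vec ⬝ᵥ z.2.vec) := by
    have h1 : ∀ i, Continuous fun z : UnitSphere2 × UnitSphere2 => z.1.vec i :=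
      fun i => (continuous_vec_apply i).comp continuous_fst
    have h2 : ∀ i, Continuous fun z : UnitSphere2 × UnitSphere2 => z.2.vec i :=
      fun i => (continuous_vec_apply i).comp continuous_snd
    simp only [dotProduct, Fin.sum_univ_three]
    fun_prop
  have hF' := continuous_sphereEval F
  have hW' := continuous_sphereEval W
  have e1 : ∀ p, sphereEval p (F * W) = ∫ q, (zonalKernel ℓ).eval (p.vec ⬝ᵥ q.vec) *
      sphereEval q F * sphereEval p W ∂sphereMeasure := by
    intro p
    rw [integral_mul_const, map_mul, ← sphereIntegral_zonalKernel_mul hF p, sphereIntegral_apply]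
    simp only [map_mul, sphereEval_zonal]
  rw [sphereIntegral_apply]
  simp only [e1]
  rw [integral_sphere_swap (by
    exact (hc.mul (hF'.comp continuous_snd)).mul (hW'.comp continuous_fst))]
  congr 1
  ext q
  rw [sphereIntegral_apply, ← integral_const_mul]
  congr 1
  ext p
  rw [map_mul, sphereEval_zonal, dotProduct_comm]
  ring

/-- Cyclic symmetry makes F an undifferentiated factor, which is then reproduced; the same is done
with G. What remains is the bracket of two zonal kernels paired with H. -/
theorem sphereIntegral_polyBracket_mul_eq {ℓ ℓ' : ℕ} {F G : MvPolynomial (Fin 3) ℝ}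
    (hF : IsSphericalEigen ℓ F) (hG : IsSphericalEigen ℓ' G) (H : MvPolynomial (Fin 3) ℝ) :
    sphereIntegral (polyBracket F G * H) =
      ∫ q, sphereEval q F * ∫ q', sphereEval q' G *
        (∫ p, bracketKernel (zonalKernel ℓ) (zonalKernel ℓ') p q q' * sphereEval p H
          ∂sphereMeasure) ∂sphereMeasure ∂sphereMeasure := by
  rw [sphereIntegral_polyBracket_mul, mul_comm, sphereIntegral_mul_eq_of_eigen hF]
  congr 1
  ext q
  congr 1
  rw [mul_comm, sphereIntegral_polyBracket_mul, mul_comm, sphereIntegral_mul_eq_of_eigen hG]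
  congr 1
  ext q'
  congr 1
  rw [mul_comm, sphereIntegral_polyBracket_mul, sphereIntegral_apply]
  simp only [map_mul, sphereEval_polyBracket_zonal]

theorem sphereIntegral_polyBracket_mul_sq_le {ℓ ℓ' : ℕ} {F G : MvPolynomial (Fin 3) ℝ}
    (hF : IsSphericalEigen ℓ F) (hG : IsSphericalEigen ℓ' G) (H : MvPolynomial (Fin 3) ℝ) :
    sphereIntegral (polyBracket F G * H) ^ 2 ≤ sphereIntegral (F ^ 2) * (sphereIntegral (G ^ 2) *
      ∫ q, ∫ q', (∫ p, bracketKernel (zonalKernel ℓ) (zonalKernel ℓ') p q q' * sphereEval p H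
        ∂sphereMeasure) ^ 2 ∂sphereMeasure ∂sphereMeasure) := by
  rw [sphereIntegral_polyBracket_mul_eq hF hG]
  set B : UnitSphere2 → UnitSphere2 → ℝ := fun q q' =>
    ∫ p, bracketKernel (zonalKernel ℓ) (zonalKernel ℓ') p q q' * sphereEval p H
      ∂sphereMeasure with hB
  have hBc : Continuous fun z : UnitSphere2 × UnitSphere2 => B z.1 z.2 := by
    refine continuous_sphere_integral (Φ := fun (z : UnitSphere2 × UnitSphere2) p =>
      bracketKernel (zonalKernel ℓ) (zonalKernel ℓ') p z.1 z.2 * sphereEval p H) ?_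
    exact (continuous_bracketKernel _ _ continuous_snd (by fun_prop) (by fun_prop)).mul
      ((continuous_sphereEval H).comp continuous_snd)
  have hBq : ∀ q, Continuous fun q' => B q q' := fun q =>
    hBc.comp (by fun_prop : Continuous fun q' : UnitSphere2 => (q, q'))
  have hGc := continuous_sphereEval G
  have h1 := integral_sphere_mul_sq_le (continuous_sphereEval F)
    (g := fun q => ∫ q', sphereEval q' G * B q q' ∂sphereMeasure)
    (continuous_sphere_integral ((hGc.comp continuous_snd).mul hBc))
  have h2 : ∫ q, (∫ q', sphereEval q' G * B q q' ∂sphereMeasure) ^ 2 ∂sphereMeasure ≤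
      ∫ q, (∫ q', sphereEval q' G ^ 2 ∂sphereMeasure) * ∫ q', B q q' ^ 2 ∂sphereMeasure
        ∂sphereMeasure := by
    refine integral_mono (integrable_sphere ?_) (integrable_sphere ?_)
      fun q => integral_sphere_mul_sq_le hGc (hBq q)
    · exact (continuous_sphere_integral ((hGc.comp continuous_snd).mul hBc)).pow 2
    · exact continuous_const.mul (continuous_sphere_integral (hBc.pow 2))
  rw [integral_const_mul] at h2
  refine h1.trans ?_
  simp only [sphereIntegral_apply, map_pow]
  exact mul_le_mul_of_nonneg_left h2 (integral_nonneg fun p => sq_nonneg _)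

/-- As a function of q' the kernel is a constant times the rotation about q applied to the zonal
function with pole p, respectively r. Moving one rotation across by parts leaves a reproducing
kernel at p, so the integral is minus the second rotation derivative of the other zonal function,
evaluated at p. -/
theorem integral_bracketKernel_mul_inner (f : Polynomial ℝ) (ℓ : ℕ) (p r q : UnitSphere2) :
    ∫ q', bracketKernel f (zonalKernel ℓ) p q q' * bracketKernel f (zonalKernel ℓ) r q q'
      ∂sphereMeasure =
    -((Polynomial.derivative f).eval (p.vec ⬝ᵥ q.vec) *
      (Polynomial.derivative f).eval (r.vec ⬝ᵥ q.vec) *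
      ((Polynomial.derivative (Polynomial.derivative (zonalKernel ℓ))).eval (r.vec ⬝ᵥ p.vec) *
          (crossProduct r.vec q.vec ⬝ᵥ p.vec) ^ 2 +
        (Polynomial.derivative (zonalKernel ℓ)).eval (r.vec ⬝ᵥ p.vec) *
          (crossProduct (crossProduct r.vec q.vec) q.vec ⬝ᵥ p.vec))) := by
  set g := zonalKernel ℓ with hg
  have hR := ((isSphericalEigen_zonalKernel r ℓ).rotDer q.vec).rotDer q.vec
  have h1 := sphereIntegral_zonalKernel_mul hR p
  have h2 := sphereIntegral_rotDer_mul q.vec (zonal p.vec g) (rotDer q.vec (zonal r.vec g))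
  rw [h1] at h2
  have e1 : ∀ s : UnitSphere2, sphereEval p (rotDer s.vec (rotDer s.vec (zonal r.vec g))) =
      (Polynomial.derivative (Polynomial.derivative g)).eval (r.vec ⬝ᵥ p.vec) *
          (crossProduct r.vec s.vec ⬝ᵥ p.vec) ^ 2 +
        (Polynomial.derivative g).eval (r.vec ⬝ᵥ p.vec) *
          (crossProduct (crossProduct r.vec s.vec) s.vec ⬝ᵥ p.vec) := by
    intro s
    have hl : ∀ a, sphereEval p (linForm a) = a ⬝ᵥ p.vec := fun a => eval_linForm _ _
    simp only [rotDer_zonal, Derivation.leibniz, rotDer_linForm, smul_eq_mul, map_add, map_mul,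
      sphereEval_zonal, hl]
    ring
  rw [← e1 q, ← mul_neg, ← h2, sphereIntegral_apply, ← integral_const_mul]
  congr 1
  ext q'
  have hl : ∀ a, sphereEval q' (linForm a) = a ⬝ᵥ q'.vec := fun a => eval_linForm _ _
  simp only [rotDer_zonal, map_mul, sphereEval_zonal, hl, bracketKernel]
  rw [dotProduct_comm q.vec p.vec, dotProduct_comm q.vec r.vec, dotProduct_comm q'.vec p.vec,
    dotProduct_comm q'.vec r.vec]
  have c1 : ∀ s : UnitSphere2, crossProduct q.vec q'.vec ⬝ᵥ s.vec =
      crossProduct s.vec q.vec ⬝ᵥ q'.vec := fun s => by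
    simp [dotProduct, Fin.sum_univ_three, cross_apply]
    ring
  rw [c1, c1]
  ring

theorem integral_bracketKernel_mul (ℓ ℓ' : ℕ) (p r : UnitSphere2) :
    ∫ q, ∫ q', bracketKernel (zonalKernel ℓ) (zonalKernel ℓ') p q q' *
      bracketKernel (zonalKernel ℓ) (zonalKernel ℓ') r q q' ∂sphereMeasure ∂sphereMeasure =
    (-Polynomial.derivative ((1 - Polynomial.X ^ 2) * (Polynomial.derivative (zonalKernel ℓ) *
      Polynomial.derivative (zonalKernel ℓ')))).eval (p.vec ⬝ᵥ r.vec) := by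
  set f := zonalKernel ℓ with hf
  set g := zonalKernel ℓ' with hg
  have hl : ∀ s a, sphereEval s (linForm a) = a ⬝ᵥ s.vec := fun s a => eval_linForm _ _
  have hrr := r.vec_dot_self
  have hpp := p.vec_dot_self
  -- The coefficient of g'': up to sign the integrand is the product of the zonal function at p
  -- rotated about r and the one at r rotated about p, so parts and reproduction apply again.
  have h1 : sphereIntegral (zonal p.vec (Polynomial.derivative f) *
      zonal r.vec (Polynomial.derivative f) * linForm (crossProduct p.vec r.vec) ^ 2) =
      (Polynomial.derivative f).eval (p.vec ⬝ᵥ r.vec) * (1 - (p.vec ⬝ᵥ r.vec) ^ 2) := by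
    have a1 := sphereIntegral_rotDer_mul r.vec (zonal p.vec f) (rotDer p.vec (zonal r.vec f))
    rw [sphereIntegral_zonalKernel_mul
      (((isSphericalEigen_zonalKernel r ℓ).rotDer p.vec).rotDer r.vec) p] at a1
    have a2 : sphereIntegral (zonal p.vec (Polynomial.derivative f) *
      zonal r.vec (Polynomial.derivative f) * linForm (crossProduct p.vec r.vec) ^ 2) =
      -sphereIntegral (rotDer r.vec (zonal p.vec f) * rotDer p.vec (zonal r.vec f)) := by
      rw [← map_neg]
      refine sphereIntegral_congr fun q => ?_
      simp only [rotDer_zonal, map_mul, map_neg, map_pow, hl]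
      simp [dotProduct, Fin.sum_univ_three, cross_apply]
      ring
    rw [a2, a1, neg_neg]
    simp only [rotDer_zonal, Derivation.leibniz, rotDer_linForm, smul_eq_mul, map_add, map_mul,
      sphereEval_zonal, hl, dotProduct_comm p.vec r.vec]
    have b1 : crossProduct (crossProduct r.vec p.vec) r.vec ⬝ᵥ p.vec =
        (r.vec ⬝ᵥ r.vec) * (p.vec ⬝ᵥ p.vec) - (r.vec ⬝ᵥ p.vec) ^ 2 := by
      simp [dotProduct, Fin.sum_univ_three, cross_apply]
      ring
    have b2 : crossProduct r.vec r.vec = 0 := cross_self _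
    rw [b1, b2, hrr, hpp, zero_dotProduct]
    ring
  -- The coefficient of g': up to sign the integrand is the inner product of the gradients of the
  -- two zonal functions, which integrates to a Laplacian. Together the two coefficients form the
  -- derivative of (1-t²) f' g'.
  have h2 : sphereIntegral (zonal p.vec (Polynomial.derivative f) *
      zonal r.vec (Polynomial.derivative f) *
      (linForm r.vec * linForm p.vec - C (r.vec ⬝ᵥ p.vec))) =
      (legendreOp f).eval (p.vec ⬝ᵥ r.vec) := by
    have hE := isSphericalEigen_zonalKernel r ℓ
    have a0 : ∀ i, sphereIntegral (axisDer i (zonal p.vec f) * axisDer i (zonal r.vec f)) =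
        -sphereEval p (axisDer i (axisDer i (zonal r.vec f))) := fun i => by
      rw [sphereIntegral_rotDer_mul, sphereIntegral_zonalKernel_mul ((hE.rotDer _).rotDer _)]
    have a1 : sphereEval p (sphereLaplacian (zonal r.vec f)) =
        (legendreOp f).eval (p.vec ⬝ᵥ r.vec) := by
      rw [dotProduct_comm]
      exact eval_sphereLaplacian_zonal hrr hpp f
    rw [← a1, sphereLaplacian, map_add, map_add, ← neg_eq_iff_eq_neg.mpr (a0 0),
      ← neg_eq_iff_eq_neg.mpr (a0 1), ← neg_eq_iff_eq_neg.mpr (a0 2), ← map_neg, ← map_neg,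
      ← map_neg, ← map_add, ← map_add]
    refine sphereIntegral_congr fun q => ?_
    have hqq := q.vec_dot_self
    simp only [rotDer_zonal, map_mul, map_neg, map_add, map_sub, hl, eval_C]
    simp [dotProduct, Fin.sum_univ_three, cross_apply] at hqq ⊢
    generalize sphereEval q (zonal p.vec (Polynomial.derivative f)) = u
    generalize sphereEval q (zonal r.vec (Polynomial.derivative f)) = v
    linear_combination (u * v * (p.vec 0 * r.vec 0 + p.vec 1 * r.vec 1 + p.vec 2 * r.vec 2)) * hqq
  have h4 := integral_bracketKernel_mul_inner f ℓ' p r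
  rw [← hg] at h4
  have h3 : ∀ q : UnitSphere2, -((Polynomial.derivative f).eval (p.vec ⬝ᵥ q.vec) *
      (Polynomial.derivative f).eval (r.vec ⬝ᵥ q.vec) *
      ((Polynomial.derivative (Polynomial.derivative g)).eval (r.vec ⬝ᵥ p.vec) *
          (crossProduct r.vec q.vec ⬝ᵥ p.vec) ^ 2 +
        (Polynomial.derivative g).eval (r.vec ⬝ᵥ p.vec) *
          (crossProduct (crossProduct r.vec q.vec) q.vec ⬝ᵥ p.vec))) =
      sphereEval q (C (-(Polynomial.derivative (Polynomial.derivative g)).eval (r.vec ⬝ᵥ p.vec)) *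
        (zonal p.vec (Polynomial.derivative f) *
          zonal r.vec (Polynomial.derivative f) * linForm (crossProduct p.vec r.vec) ^ 2) +
        C (-(Polynomial.derivative g).eval (r.vec ⬝ᵥ p.vec)) *
          (zonal p.vec (Polynomial.derivative f) * zonal r.vec (Polynomial.derivative f) *
      (linForm r.vec * linForm p.vec - C (r.vec ⬝ᵥ p.vec)))) := by
    intro q
    have hqq := q.vec_dot_self
    have c1 : crossProduct r.vec q.vec ⬝ᵥ p.vec = crossProduct p.vec r.vec ⬝ᵥ q.vec := by
      simp [dotProduct, Fin.sum_univ_three, cross_apply]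
      ring
    have c2 : crossProduct (crossProduct r.vec q.vec) q.vec ⬝ᵥ p.vec =
        (r.vec ⬝ᵥ q.vec) * (p.vec ⬝ᵥ q.vec) - (r.vec ⬝ᵥ p.vec) * (q.vec ⬝ᵥ q.vec) := by
      simp [dotProduct, Fin.sum_univ_three, cross_apply]
      ring
    rw [c1, c2, hqq]
    simp only [map_add, map_mul, map_sub, map_pow, eval_C, hl, sphereEval_zonal]
    ring
  simp only [h4, h3]
  rw [← sphereIntegral_apply, map_add, sphereIntegral_C_mul, sphereIntegral_C_mul, h1, h2,
    legendreOp_apply, dotProduct_comm r.vec p.vec]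
  simp
  ring

theorem integral_sq_integral_bracketKernel {L : ℕ} (ℓ ℓ' : ℕ) {H : MvPolynomial (Fin 3) ℝ}
    (hH : IsSphericalEigen L H) :
    ∫ q, ∫ q', (∫ p, bracketKernel (zonalKernel ℓ) (zonalKernel ℓ') p q q' * sphereEval p H
      ∂sphereMeasure) ^ 2 ∂sphereMeasure ∂sphereMeasure =
    2 * Real.pi * integralPoly ((1 - Polynomial.X ^ 2) * (Polynomial.derivative (zonalKernel ℓ) *
      Polynomial.derivative (zonalKernel ℓ')) * Polynomial.derivative (legendreP L)) *
      sphereIntegral (H ^ 2) := by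
  set D := bracketKernel (zonalKernel ℓ) (zonalKernel ℓ') with hD
  set k := (1 - Polynomial.X ^ 2) * (Polynomial.derivative (zonalKernel ℓ) *
    Polynomial.derivative (zonalKernel ℓ')) with hk
  -- The square becomes a double integral over p and r, so that the poles q and q' can be integrated
  -- out first.
  have e1 : ∀ q q', (∫ p, D p q q' * sphereEval p H ∂sphereMeasure) ^ 2 =
      ∫ p, ∫ r, D p q q' * sphereEval p H * (D r q q' * sphereEval r H)
        ∂sphereMeasure ∂sphereMeasure := by
    intro q q'
    simp only [integral_const_mul, integral_mul_const]
    ring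
  have hHc := continuous_sphereEval H
  simp only [e1]
  rw [integral_sphere_swap_pairs (by
    refine Continuous.mul (Continuous.mul ?_ ?_) (Continuous.mul ?_ ?_)
    · exact continuous_bracketKernel _ _ (by fun_prop) (by fun_prop) (by fun_prop)
    · exact hHc.comp (by fun_prop : Continuous fun z :
        (UnitSphere2 × UnitSphere2) × (UnitSphere2 × UnitSphere2) => z.2.1)
    · exact continuous_bracketKernel _ _ (by fun_prop) (by fun_prop) (by fun_prop)
    · exact hHc.comp (by fun_prop : Continuous fun z :
        (UnitSphere2 × UnitSphere2) × (UnitSphere2 × UnitSphere2) => z.2.2))]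
  have e2 : ∀ p r, ∫ q, ∫ q', D p q q' * sphereEval p H * (D r q q' * sphereEval r H)
      ∂sphereMeasure ∂sphereMeasure =
      sphereEval p H * ((-Polynomial.derivative k).eval (p.vec ⬝ᵥ r.vec) * sphereEval r H) := by
    intro p r
    rw [hk, ← integral_bracketKernel_mul ℓ ℓ' p r]
    simp only [← integral_mul_const, ← integral_const_mul]
    congr 1; ext q; congr 1; ext q'
    ring
  have e3 : ∀ p, ∫ r, (-Polynomial.derivative k).eval (p.vec ⬝ᵥ r.vec) * sphereEval r H
      ∂sphereMeasure = 2 * Real.pi * sphereEval p H *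
        integralPoly (k * Polynomial.derivative (legendreP L)) := by
    intro p
    have h := funkHecke hH p (-Polynomial.derivative k)
    rw [sphereIntegral_apply] at h
    simp only [map_mul, sphereEval_zonal] at h
    rw [h]
    congr 1
    -- Integration by parts moves the derivative from k to the Legendre polynomial; k vanishes at
    -- ±1.
    have hi := integralPoly_derivative (k * legendreP L)
    have k1 : k.eval 1 = 0 := by simp [hk]
    have k2 : k.eval (-1) = 0 := by simp [hk]
    rw [Polynomial.derivative_mul, map_add, Polynomial.eval_mul (p := k),
      Polynomial.eval_mul (p := k), k1, k2] at hi
    rw [neg_mul, map_neg]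
    linarith
  simp only [e2, integral_const_mul, e3]
  rw [sphereIntegral_apply, ← integral_const_mul]
  congr 1; ext p
  rw [map_pow]
  ring

/-- The basic bound: the bracket of two eigenfunctions against a third one. -/
theorem sphereIntegral_polyBracket_mul_sq_le_integralPoly {ℓ ℓ' L : ℕ}
    {F G H : MvPolynomial (Fin 3) ℝ} (hF : IsSphericalEigen ℓ F) (hG : IsSphericalEigen ℓ' G)
    (hH : IsSphericalEigen L H) :
    sphereIntegral (polyBracket F G * H) ^ 2 ≤
      (2 * ℓ + 1) * (2 * ℓ' + 1) / (8 * Real.pi) * integralPoly ((1 - Polynomial.X ^ 2) *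
        (Polynomial.derivative (legendreP ℓ) * Polynomial.derivative (legendreP ℓ')) *
          Polynomial.derivative (legendreP L)) *
      (sphereIntegral (F ^ 2) * sphereIntegral (G ^ 2) * sphereIntegral (H ^ 2)) := by
  refine (sphereIntegral_polyBracket_mul_sq_le hF hG H).trans (le_of_eq ?_)
  have e : (1 - Polynomial.X ^ 2) * (Polynomial.derivative (zonalKernel ℓ) *
      Polynomial.derivative (zonalKernel ℓ')) * Polynomial.derivative (legendreP L) =
      Polynomial.C ((2 * ℓ + 1) / (4 * Real.pi) * ((2 * ℓ' + 1) / (4 * Real.pi))) *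
      ((1 - Polynomial.X ^ 2) * (Polynomial.derivative (legendreP ℓ) *
        Polynomial.derivative (legendreP ℓ')) * Polynomial.derivative (legendreP L)) := by
    rw [zonalKernel, zonalKernel, Polynomial.derivative_C_mul, Polynomial.derivative_C_mul,
      Polynomial.C_mul]
    ring
  have hpi := Real.pi_pos
  rw [integral_sq_integral_bracketKernel ℓ ℓ' hH, e, integralPoly_C_mul]
  field_simp
  ring

end HilbertSchmidt

/-! ### The bound for eigenfunctions -/

section EigenBound

open MvPolynomial

/-- The smallest degree is placed in the factor estimated in L¹, the other two in the Bernstein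
factors. If b is the middle degree, L ≤ a + b ≤ 2b makes √(bL) at most 2b. -/
theorem integralPoly_triple_derivative_legendreP_le_mul {a b L : ℕ} (ha : 1 ≤ a) (hb : 1 ≤ b)
    (haL : a ≤ L) (hbL : b ≤ L) (hL : L ≤ a + b) :
    integralPoly ((1 - Polynomial.X ^ 2) * (Polynomial.derivative (legendreP a) *
      Polynomial.derivative (legendreP b)) * Polynomial.derivative (legendreP L)) ≤
    308 * Real.pi * (a * b) := by
  wlog hab : a ≤ b generalizing a b
  · rw [mul_comm (Polynomial.derivative (legendreP a)), mul_comm (a : ℝ)]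
    exact this hb ha hbL haL (by omega) (by omega)
  refine (integralPoly_triple_derivative_legendreP_le ha hb (ha.trans haL)).trans ?_
  have h : √((b : ℝ) * L) ≤ 2 * b := by
    have h1 : (L : ℝ) ≤ 2 * b := by exact_mod_cast (by omega : L ≤ 2 * b)
    rw [Real.sqrt_le_left (by positivity)]
    nlinarith [(Nat.cast_nonneg b : (0 : ℝ) ≤ b)]
  have hpi := Real.pi_pos
  calc 154 * Real.pi * a * √((b : ℝ) * L) ≤ 154 * Real.pi * a * (2 * b) := by gcongr
    _ = _ := by ring

theorem sphereIntegral_sq_nonneg (F : MvPolynomial (Fin 3) ℝ) : 0 ≤ sphereIntegral (F ^ 2) := by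
  rw [sphereIntegral_apply]
  refine integral_nonneg fun p => ?_
  rw [map_pow]
  exact sq_nonneg _

theorem abs_sphereIntegral_polyBracket_mul_le_of_le {ℓ ℓ' L : ℕ} {F G H : MvPolynomial (Fin 3) ℝ}
    (hF : IsSphericalEigen ℓ F) (hG : IsSphericalEigen ℓ' G) (hH : IsSphericalEigen L H)
    (hF2 : sphereIntegral (F ^ 2) ≤ 2) (hG2 : sphereIntegral (G ^ 2) ≤ 2)
    (hH2 : sphereIntegral (H ^ 2) ≤ 2) (h1 : 1 ≤ ℓ) (h2 : 1 ≤ ℓ') (h3 : ℓ ≤ L) (h4 : ℓ' ≤ L)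
    (h5 : L ≤ ℓ + ℓ') :
    |sphereIntegral (polyBracket F G * H)| ≤ 54 * ((ℓ : ℝ) * ℓ') := by
  refine abs_le_of_sq_le_sq ?_ (by positivity)
  refine (sphereIntegral_polyBracket_mul_sq_le_integralPoly hF hG hH).trans ?_
  have hI := integralPoly_triple_derivative_legendreP_le_mul h1 h2 h3 h4 h5
  have hpi := Real.pi_pos
  have hl : (1 : ℝ) ≤ ℓ := by exact_mod_cast h1
  have hl' : (1 : ℝ) ≤ ℓ' := by exact_mod_cast h2
  have hn : sphereIntegral (F ^ 2) * sphereIntegral (G ^ 2) * sphereIntegral (H ^ 2) ≤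
      2 * 2 * 2 := by
    have := sphereIntegral_sq_nonneg F
    have := sphereIntegral_sq_nonneg G
    have := sphereIntegral_sq_nonneg H
    gcongr
  have hn0 : 0 ≤ sphereIntegral (F ^ 2) * sphereIntegral (G ^ 2) * sphereIntegral (H ^ 2) :=
    mul_nonneg (mul_nonneg (sphereIntegral_sq_nonneg F) (sphereIntegral_sq_nonneg G))
      (sphereIntegral_sq_nonneg H)
  have hc : (2 * (ℓ : ℝ) + 1) * (2 * ℓ' + 1) / (8 * Real.pi) ≤
      (3 * ℓ) * (3 * ℓ') / (8 * Real.pi) := by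
    gcongr <;> linarith
  -- The constants combine to 9/(8π) · 308π · 8 = 2772 ≤ 54².
  calc _ ≤ (3 * (ℓ : ℝ)) * (3 * ℓ') / (8 * Real.pi) * (308 * Real.pi * (ℓ * ℓ')) *
        (2 * 2 * 2) := by
        refine mul_le_mul ?_ hn hn0 (by positivity)
        exact (mul_le_mul_of_nonneg_left hI (by positivity)).trans
          (mul_le_mul_of_nonneg_right hc (by positivity))
    _ = 2772 * ((ℓ : ℝ) * ℓ') ^ 2 := by field_simp; ring
    _ ≤ (54 * ((ℓ : ℝ) * ℓ')) ^ 2 := by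
        nlinarith [sq_nonneg ((ℓ : ℝ) * ℓ')]

/-- The minimum is the product of the two smaller degrees, so cyclic symmetry is used to put the
largest one last. -/
theorem abs_sphereIntegral_polyBracket_mul_le {ℓ ℓ' L : ℕ} {F G H : MvPolynomial (Fin 3) ℝ}
    (hF : IsSphericalEigen ℓ F) (hG : IsSphericalEigen ℓ' G) (hH : IsSphericalEigen L H)
    (hF2 : sphereIntegral (F ^ 2) ≤ 2) (hG2 : sphereIntegral (G ^ 2) ≤ 2)
    (hH2 : sphereIntegral (H ^ 2) ≤ 2) (h1 : 1 ≤ ℓ) (h2 : 1 ≤ ℓ') (h3 : 1 ≤ L)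
    (t1 : ℓ ≤ ℓ' + L) (t2 : ℓ' ≤ ℓ + L) (t3 : L ≤ ℓ + ℓ') :
    |sphereIntegral (polyBracket F G * H)| ≤
      54 * min ((ℓ : ℝ) * ℓ') (min ((ℓ : ℝ) * L) ((ℓ' : ℝ) * L)) := by
  have key : ∀ {a b c : ℕ}, a ≤ c → b ≤ c → (a : ℝ) * b ≤ a * c ∧ (a : ℝ) * b ≤ b * c :=
    fun {a b c} ha hb => by
      have ha' : (a : ℝ) ≤ c := by exact_mod_cast ha
      have hb' : (b : ℝ) ≤ c := by exact_mod_cast hb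
      exact ⟨by gcongr, by rw [mul_comm (a : ℝ)]; gcongr⟩
  by_cases hL : ℓ ≤ L ∧ ℓ' ≤ L
  · obtain ⟨k1, k2⟩ := key hL.1 hL.2
    refine (abs_sphereIntegral_polyBracket_mul_le_of_le hF hG hH hF2 hG2 hH2 h1 h2 hL.1 hL.2
      t3).trans (mul_le_mul_of_nonneg_left (le_min le_rfl (le_min k1 k2)) (by norm_num))
  · by_cases hl : ℓ' ≤ ℓ ∧ L ≤ ℓ
    · obtain ⟨k1, k2⟩ := key hl.1 hl.2
      rw [sphereIntegral_polyBracket_mul]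
      refine (abs_sphereIntegral_polyBracket_mul_le_of_le hG hH hF hG2 hH2 hF2 h2 h3 hl.1 hl.2
        t1).trans (mul_le_mul_of_nonneg_left (le_min ?_ (le_min ?_ le_rfl)) (by norm_num))
      · linarith
      · linarith
    · have hl' : L ≤ ℓ' ∧ ℓ ≤ ℓ' := by omega
      obtain ⟨k1, k2⟩ := key hl'.1 hl'.2
      rw [sphereIntegral_polyBracket_mul, sphereIntegral_polyBracket_mul]
      refine (abs_sphereIntegral_polyBracket_mul_le_of_le hH hF hG hH2 hF2 hG2 h3 h1 hl'.1 hl'.2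
        (by omega)).trans (mul_le_mul_of_nonneg_left (le_min ?_ (le_min ?_ ?_)) (by norm_num))
      · linarith
      · linarith
      · linarith

end EigenBound

/-! ### The Poisson bracket of the sphere on restrictions of polynomials -/

section Gradient

open MvPolynomial

theorem hasFDerivAt_eval_comp {E : Type*} [NormedAddCommGroup E] [NormedSpace ℝ E]
    {u : E → Fin 3 → ℝ} {u' : Fin 3 → E →L[ℝ] ℝ} {x : E}
    (hu : ∀ j, HasFDerivAt (fun x => u x j) (u' j) x) (F : MvPolynomial (Fin 3) ℝ) :
    HasFDerivAt (fun x => eval (u x) F) (eval (u x) (pderiv 0 F) • u' 0 +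
      eval (u x) (pderiv 1 F) • u' 1 + eval (u x) (pderiv 2 F) • u' 2) x := by
  induction F using MvPolynomial.induction_on with
  | C a => simpa using hasFDerivAt_const a x
  | add p q hp hq =>
    simp only [map_add]
    refine (hp.add hq).congr_fderiv ?_
    module
  | mul_X p j hp =>
    simp only [map_mul, eval_X]
    refine (hp.mul (hu j)).congr_fderiv ?_
    simp only [Derivation.leibniz, pderiv_X, smul_eq_mul, map_add, map_mul, eval_X]
    fin_cases j <;> simp <;> module

/-- The gradient of the restriction of a polynomial to the sphere. -/
noncomputable def polyGradient (F : MvPolynomial (Fin 3) ℝ) (p : UnitSphere2) (i : Fin 3) : ℝ :=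
  sphereEval p (pderiv i F) - p.vec i * (p.vec 0 * sphereEval p (pderiv 0 F) +
    p.vec 1 * sphereEval p (pderiv 1 F) + p.vec 2 * sphereEval p (pderiv 2 F))

/-- Chain rule for x ↦ x/‖x‖, whose derivative at p is the orthogonal projection onto the tangent
plane. The gradient is thus the Euclidean one minus its radial part. -/
theorem exists_hasFDerivAt_radialExtension (F : MvPolynomial (Fin 3) ℝ) (p : UnitSphere2) :
    ∃ A : EuclideanSpace ℝ (Fin 3) →L[ℝ] ℝ,
      HasFDerivAt (radialExtension fun q : UnitSphere2 => sphereEval q F) A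
        (p : EuclideanSpace ℝ (Fin 3)) ∧
      ∀ i, A (EuclideanSpace.single i 1) = polyGradient F p i := by
  set x₀ : EuclideanSpace ℝ (Fin 3) := p.1 with hx₀
  have hn : ‖x₀‖ = 1 := by simp [hx₀]
  have hsq := (hasStrictFDerivAt_norm_sq x₀).hasFDerivAt
  have hd : HasDerivAt (fun s : ℝ => (√s)⁻¹) (-(1 / 2)) (‖x₀‖ ^ 2) := by
    rw [hn]
    have h1 : HasDerivAt (fun s : ℝ => √s) (1 / 2) (1 ^ 2 : ℝ) := by
      have := Real.hasDerivAt_sqrt (x := (1 ^ 2 : ℝ)) (by norm_num)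
      simpa using this
    exact (h1.inv (by simp)).congr_deriv (by simp)
  have hinv : HasFDerivAt (fun x : EuclideanSpace ℝ (Fin 3) => ‖x‖⁻¹) (-(innerSL ℝ x₀)) x₀ := by
    have h := hd.comp_hasFDerivAt x₀ hsq
    have e : (fun x : EuclideanSpace ℝ (Fin 3) => ‖x‖⁻¹) =
        (fun s : ℝ => (√s)⁻¹) ∘ fun x => ‖x‖ ^ 2 := by
      ext x
      simp [Real.sqrt_sq (norm_nonneg x)]
    rw [e]
    refine h.congr_fderiv ?_
    ext v
    simp
  have hu : ∀ j : Fin 3, HasFDerivAt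
      (fun x : EuclideanSpace ℝ (Fin 3) => ‖x‖⁻¹ * x j)
      (‖x₀‖⁻¹ • (EuclideanSpace.proj j : EuclideanSpace ℝ (Fin 3) →L[ℝ] ℝ) +
        x₀ j • -(innerSL ℝ x₀)) x₀ := fun j =>
    hinv.mul ((EuclideanSpace.proj j : EuclideanSpace ℝ (Fin 3) →L[ℝ] ℝ).hasFDerivAt)
  have h := hasFDerivAt_eval_comp (u := fun (x : EuclideanSpace ℝ (Fin 3)) j => ‖x‖⁻¹ * x j) hu F
  refine ⟨_, h.congr_of_eventuallyEq ?_, ?_⟩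
  · have hne : x₀ ≠ 0 := by
      intro h0
      simp [h0] at hn
    filter_upwards [isOpen_ne.mem_nhds hne] with x hx
    rw [radialExtension, dif_pos hx]
    rfl
  · intro i
    rw [polyGradient]
    simp only [hn]
    fin_cases i <;> simp [UnitSphere2.vec, ← hx₀, EuclideanSpace.inner_single_right] <;> ring

theorem sphereGradient_sphereEval (F : MvPolynomial (Fin 3) ℝ) (p : UnitSphere2) :
    sphereGradient (fun q : UnitSphere2 => sphereEval q F) p = polyGradient F p := by
  ext i
  obtain ⟨A, hA, h⟩ := exists_hasFDerivAt_radialExtension F p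
  rw [sphereGradient, hA.fderiv, h]

theorem sphereGradient_complex (F F' : MvPolynomial (Fin 3) ℝ) (p : UnitSphere2) :
    sphereGradient (fun q : UnitSphere2 => (sphereEval q F : ℂ) + (sphereEval q F' : ℂ) * Complex.I)
      p = fun i => (polyGradient F p i : ℂ) + (polyGradient F' p i : ℂ) * Complex.I := by
  ext i
  obtain ⟨A, hA, h⟩ := exists_hasFDerivAt_radialExtension F p
  obtain ⟨A', hA', h'⟩ := exists_hasFDerivAt_radialExtension F' p
  have e : radialExtension (fun q : UnitSphere2 =>
      (sphereEval q F : ℂ) + (sphereEval q F' : ℂ) * Complex.I) = fun x =>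
      ((radialExtension (fun q : UnitSphere2 => sphereEval q F) x : ℝ) : ℂ) +
      ((radialExtension (fun q : UnitSphere2 => sphereEval q F') x : ℝ) : ℂ) * Complex.I := by
    ext x
    by_cases hx : x = 0
    · simp [radialExtension, hx]
    · simp [radialExtension, hx]
  have hd := (Complex.ofRealCLM.hasFDerivAt.comp (p : EuclideanSpace ℝ (Fin 3)) hA).add
    ((Complex.ofRealCLM.hasFDerivAt.comp (p : EuclideanSpace ℝ (Fin 3)) hA').mul_const Complex.I)
  rw [sphereGradient, e]
  have hd' := hd.fderiv
  simp only [Function.comp_def, Complex.ofRealCLM_apply] at hd'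
  refine (congrArg (fun T => T (EuclideanSpace.single i 1)) hd').trans ?_
  simp [h, h', mul_comm]

/-- The radial parts subtracted from the gradients are multiples of p and drop out of the triple
product with p. -/
theorem spherePoisson_sphereEval (F G : MvPolynomial (Fin 3) ℝ) (p : UnitSphere2) :
    spherePoisson (fun q : UnitSphere2 => sphereEval q F) (fun q => sphereEval q G) p =
      sphereEval p (polyBracket F G) := by
  rw [spherePoisson, sphereGradient_sphereEval, sphereGradient_sphereEval]
  simp only [polyBracket, map_add, map_sub, map_mul, eval_X]
  simp [dotProduct, Fin.sum_univ_three, cross_apply, polyGradient, UnitSphere2.vec]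
  ring

theorem spherePoisson_complex (F F' G G' : MvPolynomial (Fin 3) ℝ) (p : UnitSphere2) :
    spherePoisson
      (fun q : UnitSphere2 => (sphereEval q F : ℂ) + (sphereEval q F' : ℂ) * Complex.I)
      (fun q : UnitSphere2 => (sphereEval q G : ℂ) + (sphereEval q G' : ℂ) * Complex.I) p =
      (sphereEval p (polyBracket F G - polyBracket F' G') : ℂ) +
        (sphereEval p (polyBracket F G' + polyBracket F' G) : ℂ) * Complex.I := by
  rw [spherePoisson, sphereGradient_complex, sphereGradient_complex]
  simp only [polyBracket, map_add, map_sub, map_mul, eval_X]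
  simp [dotProduct, Fin.sum_univ_three, cross_apply, polyGradient, UnitSphere2.vec]
  linear_combination
    (((p : EuclideanSpace ℝ (Fin 3)) 0 : ℂ) *
      ((sphereEval p (pderiv 1 F') : ℂ) * (sphereEval p (pderiv 2 G') : ℂ) -
        (sphereEval p (pderiv 2 F') : ℂ) * (sphereEval p (pderiv 1 G') : ℂ)) +
    ((p : EuclideanSpace ℝ (Fin 3)) 1 : ℂ) *
      ((sphereEval p (pderiv 2 F') : ℂ) * (sphereEval p (pderiv 0 G') : ℂ) -
        (sphereEval p (pderiv 0 F') : ℂ) * (sphereEval p (pderiv 2 G') : ℂ)) +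
    ((p : EuclideanSpace ℝ (Fin 3)) 2 : ℂ) *
      ((sphereEval p (pderiv 0 F') : ℂ) * (sphereEval p (pderiv 1 G') : ℂ) -
        (sphereEval p (pderiv 1 F') : ℂ) * (sphereEval p (pderiv 0 G') : ℂ))) * Complex.I_sq

end Gradient

/-! ### Spherical harmonics as polynomials -/

section Harmonics

open MvPolynomial

/-- The real and imaginary parts of `(x + iy)^m`. -/
noncomputable def planarHarmonic : ℕ → MvPolynomial (Fin 3) ℝ × MvPolynomial (Fin 3) ℝ
  | 0 => (1, 0)
  | m + 1 => (X 0 * (planarHarmonic m).1 - X 1 * (planarHarmonic m).2,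
      X 0 * (planarHarmonic m).2 + X 1 * (planarHarmonic m).1)

theorem sphereEval_planarHarmonic (m : ℕ) (p : UnitSphere2) :
    (sphereEval p (planarHarmonic m).1 : ℂ) + (sphereEval p (planarHarmonic m).2 : ℂ) * Complex.I =
      (((p : EuclideanSpace ℝ (Fin 3)) 0 : ℝ) +
        ((p : EuclideanSpace ℝ (Fin 3)) 1 : ℝ) * Complex.I) ^ m := by
  induction m with
  | zero => simp [planarHarmonic]
  | succ m ih =>
    rw [pow_succ, ← ih]
    simp only [planarHarmonic, map_add, map_sub, map_mul, eval_X]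
    push_cast
    linear_combination (-((p : EuclideanSpace ℝ (Fin 3)) 1 : ℂ) *
      (sphereEval p (planarHarmonic m).2 : ℂ)) * Complex.I_sq

theorem planarHarmonic_sq_add_sq (m : ℕ) (p : UnitSphere2) :
    sphereEval p (planarHarmonic m).1 ^ 2 + sphereEval p (planarHarmonic m).2 ^ 2 =
      (1 - (p : EuclideanSpace ℝ (Fin 3)) 2 ^ 2) ^ m := by
  induction m with
  | zero => simp [planarHarmonic]
  | succ m ih =>
    rw [pow_succ (1 - _), ← ih]
    simp only [planarHarmonic, map_add, map_sub, map_mul, eval_X]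
    linear_combination (sphereEval p (planarHarmonic m).1 ^ 2 +
      sphereEval p (planarHarmonic m).2 ^ 2) * p.sum_sq

theorem axisDer_X (i j : Fin 3) : axisDer i (X j) =
    if j = i then 0 else if j = i + 1 then -X (i + 2) else X (i + 1) := by
  fin_cases i <;> fin_cases j <;> simp [axisDer, rotDer_X_zero, rotDer_X_one, rotDer_X_two]

/-- For w = (x+iy)^m these say that w has weight m for rotation about the z-axis, is annihilated by
the raising operator D0 + i D1, has the stated gradient pairing with z, and has eigenvalue -m(m+1).
They are proved together because the induction for the Laplacian uses the first two pairs. -/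
theorem planarHarmonic_axisDer (m : ℕ) :
    (axisDer 2 (planarHarmonic m).1 = -(m : MvPolynomial (Fin 3) ℝ) * (planarHarmonic m).2 ∧
      axisDer 2 (planarHarmonic m).2 = (m : MvPolynomial (Fin 3) ℝ) * (planarHarmonic m).1) ∧
    (axisDer 0 (planarHarmonic m).2 = -axisDer 1 (planarHarmonic m).1 ∧
      axisDer 0 (planarHarmonic m).1 = axisDer 1 (planarHarmonic m).2) ∧
    (X 1 * axisDer 0 (planarHarmonic m).1 - X 0 * axisDer 1 (planarHarmonic m).1 =
        -(m : MvPolynomial (Fin 3) ℝ) * X 2 * (planarHarmonic m).1 ∧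
      X 1 * axisDer 0 (planarHarmonic m).2 - X 0 * axisDer 1 (planarHarmonic m).2 =
        -(m : MvPolynomial (Fin 3) ℝ) * X 2 * (planarHarmonic m).2) ∧
    (sphereLaplacian (planarHarmonic m).1 =
        -(m : MvPolynomial (Fin 3) ℝ) * (m + 1) * (planarHarmonic m).1 ∧
      sphereLaplacian (planarHarmonic m).2 =
        -(m : MvPolynomial (Fin 3) ℝ) * (m + 1) * (planarHarmonic m).2) := by
  induction m with
  | zero => simp [planarHarmonic, sphereLaplacian]
  | succ m ih =>
    obtain ⟨⟨a1, a2⟩, ⟨b1, b2⟩, ⟨c1, c2⟩, ⟨d1, d2⟩⟩ := ih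
    have x00 : axisDer 0 (X 0) = 0 := by rw [axisDer_X]; simp
    have x01 : axisDer 0 (X 1) = -X 2 := by rw [axisDer_X]; simp
    have x10 : axisDer 1 (X 0) = X 2 := by rw [axisDer_X]; simp
    have x11 : axisDer 1 (X 1) = 0 := by rw [axisDer_X]; simp
    have x20 : axisDer 2 (X 0) = -X 1 := by rw [axisDer_X]; simp
    have x21 : axisDer 2 (X 1) = X 0 := by rw [axisDer_X]; simp
    have x02 : axisDer 0 (X 2) = X 1 := by rw [axisDer_X]; simp
    have x12 : axisDer 1 (X 2) = -X 0 := by rw [axisDer_X]; simp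
    simp only [sphereLaplacian] at d1 d2
    simp only [planarHarmonic, sphereLaplacian]
    generalize (planarHarmonic m).1 = A at *
    generalize (planarHarmonic m).2 = B at *
    generalize axisDer 0 = D0 at *
    generalize axisDer 1 = D1 at *
    generalize axisDer 2 = D2 at *
    simp only [map_add, map_sub, map_neg, map_zero, Derivation.leibniz, smul_eq_mul, x00, x01, x10,
      x11, x20, x21, x02, x12]
    push_cast
    refine ⟨⟨?_, ?_⟩, ⟨?_, ?_⟩, ⟨?_, ?_⟩, ⟨?_, ?_⟩⟩
    · linear_combination X 0 * a1 - X 1 * a2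
    · linear_combination X 0 * a2 + X 1 * a1
    · linear_combination X 0 * b1 + X 1 * b2
    · linear_combination X 0 * b2 - X 1 * b1
    · linear_combination X 0 * c1 - X 1 * c2
    · linear_combination X 0 * c2 + X 1 * c1
    · linear_combination X 0 * d1 - X 1 * d2 + 2 * X 2 * b1 - 2 * X 1 * a1 - 2 * X 0 * a2
    · linear_combination X 0 * d2 + X 1 * d1 - 2 * X 2 * b2 - 2 * X 1 * a2 + 2 * X 0 * a1

/-- The north pole. -/
noncomputable def northPole : UnitSphere2 := ⟨EuclideanSpace.single 2 1, by simp⟩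

theorem northPole_vec : northPole.vec = Pi.single 2 1 := by
  ext i
  simp [UnitSphere2.vec, northPole, Pi.single_apply]

theorem sphereEval_zonal_northPole (f : Polynomial ℝ) (p : UnitSphere2) :
    sphereEval p (zonal northPole.vec f) = f.eval ((p : EuclideanSpace ℝ (Fin 3)) 2) := by
  rw [sphereEval_zonal, northPole_vec]
  simp [UnitSphere2.vec]

/-- In the product rule for the Laplacian the cross term is 2Q'(z) times the left side of `h1`. The
total -m(m+1)Q + (1-z²)Q'' - 2zQ' - 2mzQ' equals -ℓ(ℓ+1)Q by the differential equation of the m-th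
Legendre derivative. -/
theorem isSphericalEigen_mul_zonal {m ℓ : ℕ} {A : MvPolynomial (Fin 3) ℝ}
    (h1 : X 1 * axisDer 0 A - X 0 * axisDer 1 A = -(m : MvPolynomial (Fin 3) ℝ) * X 2 * A)
    (h2 : sphereLaplacian A = -(m : MvPolynomial (Fin 3) ℝ) * (m + 1) * A) :
    IsSphericalEigen ℓ
      (A * zonal northPole.vec (Polynomial.derivative^[m] (legendreP ℓ))) := by
  intro p
  set Q := Polynomial.derivative^[m] (legendreP ℓ) with hQ
  have hz : ∀ i, axisDer i (zonal northPole.vec Q) =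
      zonal northPole.vec (Polynomial.derivative Q) * axisDer i (X 2) := by
    intro i
    have : linForm northPole.vec = X 2 := by simp [linForm, northPole_vec]
    rw [zonal, Derivation.map_aeval, this, smul_eq_mul, zonal, this]
  have x02 : axisDer 0 (X 2) = X 1 := by rw [axisDer_X]; simp
  have x12 : axisDer 1 (X 2) = -X 0 := by rw [axisDer_X]; simp
  have x22 : axisDer 2 (X 2) = 0 := by rw [axisDer_X]; simp
  have e : sphereLaplacian (A * zonal northPole.vec Q) =
      sphereLaplacian A * zonal northPole.vec Q + A * sphereLaplacian (zonal northPole.vec Q) +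
      2 * zonal northPole.vec (Polynomial.derivative Q) *
        (X 1 * axisDer 0 A - X 0 * axisDer 1 A) := by
    have z0 := hz 0
    have z1 := hz 1
    have z2 := hz 2
    rw [x02] at z0
    rw [x12] at z1
    rw [x22] at z2
    simp only [sphereLaplacian]
    generalize axisDer 0 = D0 at *
    generalize axisDer 1 = D1 at *
    generalize axisDer 2 = D2 at *
    simp only [Derivation.leibniz, map_add, smul_eq_mul]
    linear_combination 2 * D0 A * z0 + 2 * D1 A * z1 + 2 * D2 A * z2
  have eL : sphereEval p (sphereLaplacian (zonal northPole.vec Q)) =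
      (legendreOp Q).eval ((p : EuclideanSpace ℝ (Fin 3)) 2) := by
    have := eval_sphereLaplacian_zonal northPole.vec_dot_self p.vec_dot_self Q
    refine this.trans ?_
    rw [northPole_vec]
    simp [UnitSphere2.vec]
  have ode := eval_legendreP_ode ℓ m ((p : EuclideanSpace ℝ (Fin 3)) 2)
  rw [Function.iterate_succ_apply', Function.iterate_succ_apply', ← hQ] at ode
  rw [e, h1, h2]
  simp only [map_add, map_mul, eL, sphereEval_zonal_northPole, map_neg, map_natCast, map_one,
    map_ofNat, eval_X, legendreOp_apply, Polynomial.derivative_mul, Polynomial.eval_add,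
    Polynomial.eval_mul]
  simp
  linear_combination (sphereEval p A) * ode

/-- The normalization constant of the spherical harmonics. -/
noncomputable def harmonicConst (ℓ m : ℕ) : ℝ :=
  (-1) ^ m * √((2 * (ℓ : ℝ) + 1) / (4 * Real.pi) *
    ((Nat.factorial (ℓ - m) : ℝ) / (Nat.factorial (ℓ + m) : ℝ)))

theorem harmonicConst_sq (ℓ m : ℕ) : harmonicConst ℓ m ^ 2 = (2 * (ℓ : ℝ) + 1) / (4 * Real.pi) *
    ((Nat.factorial (ℓ - m) : ℝ) / (Nat.factorial (ℓ + m) : ℝ)) := by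
  have := Real.pi_pos
  rw [harmonicConst, mul_pow, Real.sq_sqrt (by positivity), ← pow_mul, mul_comm m, pow_mul]
  simp

theorem sphereIntegral_mono {F G : MvPolynomial (Fin 3) ℝ}
    (h : ∀ p, sphereEval p F ≤ sphereEval p G) : sphereIntegral F ≤ sphereIntegral G :=
  integral_mono (integrable_sphere (continuous_sphereEval F))
    (integrable_sphere (continuous_sphereEval G)) h

/-- Only an upper bound is needed. Bounding the square of Re or Im of (x+iy)^m by (1-z²)^m leaves a
zonal integral equal to 1, with no integration in the azimuth. -/
theorem sphereIntegral_harmonic_sq_le {ℓ m : ℕ} (hm : m ≤ ℓ) {A : MvPolynomial (Fin 3) ℝ}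
    (hA : ∀ p : UnitSphere2,
      sphereEval p A ^ 2 ≤ (1 - (p : EuclideanSpace ℝ (Fin 3)) 2 ^ 2) ^ m) :
    sphereIntegral ((C (harmonicConst ℓ m) *
      (A * zonal northPole.vec (Polynomial.derivative^[m] (legendreP ℓ)))) ^ 2) ≤ 1 := by
  have h1 : sphereIntegral (zonal northPole.vec (Polynomial.C (harmonicConst ℓ m ^ 2) *
      ((1 - Polynomial.X ^ 2) ^ m * Polynomial.derivative^[m] (legendreP ℓ) ^ 2))) = 1 := by
    have := Real.pi_pos
    have : (((ℓ + m).factorial : ℝ)) ≠ 0 := by positivity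
    have : (((ℓ - m).factorial : ℝ)) ≠ 0 := by positivity
    rw [sphereIntegral_zonal, integralPoly_C_mul,
      integralPoly_iterate_derivative_legendreP_sq ℓ m hm, harmonicConst_sq]
    field_simp
    ring
  rw [← h1]
  refine sphereIntegral_mono fun p => ?_
  simp only [map_pow, map_mul, eval_C, sphereEval_zonal_northPole, Polynomial.eval_mul,
    Polynomial.eval_pow, Polynomial.eval_C, Polynomial.eval_sub, Polynomial.eval_one,
    Polynomial.eval_X]
  rw [mul_pow, mul_pow]
  exact mul_le_mul_of_nonneg_left (mul_le_mul_of_nonneg_right (hA p) (sq_nonneg _)) (sq_nonneg _)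

/-- The standard spherical harmonics are restrictions of polynomial eigenfunctions of norm at most
one. -/
theorem exists_sphericalHarmonicNonneg_eq {ℓ m : ℕ} (hm : m ≤ ℓ) :
    ∃ F F' : MvPolynomial (Fin 3) ℝ, IsSphericalEigen ℓ F ∧ IsSphericalEigen ℓ F' ∧
      sphereIntegral (F ^ 2) ≤ 1 ∧ sphereIntegral (F' ^ 2) ≤ 1 ∧
      ∀ p, sphericalHarmonicNonneg ℓ m p =
        (sphereEval p F : ℂ) + (sphereEval p F' : ℂ) * Complex.I := by
  obtain ⟨-, -, ⟨c1, c2⟩, ⟨d1, d2⟩⟩ := planarHarmonic_axisDer m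
  have hs := planarHarmonic_sq_add_sq m
  refine ⟨C (harmonicConst ℓ m) * ((planarHarmonic m).1 *
      zonal northPole.vec (Polynomial.derivative^[m] (legendreP ℓ))),
    C (harmonicConst ℓ m) * ((planarHarmonic m).2 *
      zonal northPole.vec (Polynomial.derivative^[m] (legendreP ℓ))),
    (isSphericalEigen_mul_zonal c1 d1).C_mul _, (isSphericalEigen_mul_zonal c2 d2).C_mul _,
    sphereIntegral_harmonic_sq_le hm fun p => ?_, sphereIntegral_harmonic_sq_le hm fun p => ?_,
    fun p => ?_⟩
  · rw [← hs p]; linarith [sq_nonneg (sphereEval p (planarHarmonic m).2)]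
  · rw [← hs p]; linarith [sq_nonneg (sphereEval p (planarHarmonic m).1)]
  · simp only [map_mul, eval_C, sphereEval_zonal_northPole, iterate_derivative_legendreP,
      Polynomial.eval_mul, Polynomial.eval_C, harmonicConst]
    rw [sphericalHarmonicNonneg, ← sphereEval_planarHarmonic]
    push_cast
    ring

theorem exists_sphericalHarmonic_eq {ℓ : ℕ} {m : ℤ} (hm : |m| ≤ (ℓ : ℤ)) :
    ∃ F F' : MvPolynomial (Fin 3) ℝ, IsSphericalEigen ℓ F ∧ IsSphericalEigen ℓ F' ∧
      sphereIntegral (F ^ 2) ≤ 1 ∧ sphereIntegral (F' ^ 2) ≤ 1 ∧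
      sphericalHarmonic ℓ m = fun p =>
        (sphereEval p F : ℂ) + (sphereEval p F' : ℂ) * Complex.I := by
  obtain ⟨F, F', h1, h2, h3, h4, h5⟩ :=
    exists_sphericalHarmonicNonneg_eq (ℓ := ℓ) (m := m.natAbs)
      (by have := Int.natCast_natAbs m; omega)
  by_cases h0 : 0 ≤ m
  · refine ⟨F, F', h1, h2, h3, h4, ?_⟩
    ext p
    rw [sphericalHarmonic, if_pos h0, h5]
  · have hsq : ∀ (s : ℝ) (G : MvPolynomial (Fin 3) ℝ), s ^ 2 = 1 →
        sphereIntegral ((C s * G) ^ 2) = sphereIntegral (G ^ 2) := fun s G hs => by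
      rw [mul_pow, ← map_pow, hs, map_one, one_mul]
    have hs : ((-1 : ℝ) ^ m.natAbs) ^ 2 = 1 := by
      rw [← pow_mul, mul_comm, pow_mul]; simp
    refine ⟨C ((-1) ^ m.natAbs) * F, C (-(-1) ^ m.natAbs) * F', h1.C_mul _, h2.C_mul _, ?_, ?_, ?_⟩
    · rwa [hsq _ _ hs]
    · rwa [hsq _ _ (by rw [neg_sq, hs])]
    · ext p
      rw [sphericalHarmonic, if_neg h0, h5]
      simp only [map_mul, map_add, eval_C, Complex.conj_ofReal, Complex.conj_I]
      push_cast
      ring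

theorem exists_realSphericalHarmonic_eq {ℓ : ℕ} {m : ℤ} (hm : |m| ≤ (ℓ : ℤ)) :
    ∃ F : MvPolynomial (Fin 3) ℝ, IsSphericalEigen ℓ F ∧ sphereIntegral (F ^ 2) ≤ 2 ∧
      realSphericalHarmonic ℓ m = fun p => sphereEval p F := by
  have hre : ∀ a b : ℝ, ((a : ℂ) + (b : ℂ) * Complex.I).re = a := fun a b => by simp
  have him : ∀ a b : ℝ, ((a : ℂ) + (b : ℂ) * Complex.I).im = b := fun a b => by simp
  have hsq : ∀ (k : ℕ) (G : MvPolynomial (Fin 3) ℝ), sphereIntegral (G ^ 2) ≤ 1 →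
      sphereIntegral ((C ((-1 : ℝ) ^ k * √2) * G) ^ 2) ≤ 2 := fun k G hG => by
    have hs : ((-1 : ℝ) ^ k * √2) ^ 2 = 2 := by
      rw [mul_pow, ← pow_mul, mul_comm k, pow_mul]; simp
    rw [mul_pow, ← map_pow, hs, sphereIntegral_C_mul]
    linarith
  rcases lt_trichotomy m 0 with h | h | h
  · obtain ⟨F, F', h1, h2, h3, h4, h5⟩ :=
      exists_sphericalHarmonic_eq (ℓ := ℓ) (m := -m) (by rwa [abs_neg])
    refine ⟨_, h2.C_mul ((-1 : ℝ) ^ m.natAbs * √2), hsq _ _ h4, ?_⟩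
    ext p
    rw [realSphericalHarmonic, if_neg h.ne, if_neg (by omega), h5, map_mul, eval_C, him]
  · obtain ⟨F, F', h1, h2, h3, h4, h5⟩ := exists_sphericalHarmonic_eq hm
    refine ⟨F, h1, by linarith, ?_⟩
    subst h
    ext p
    rw [realSphericalHarmonic, if_pos rfl, h5, hre]
  · obtain ⟨F, F', h1, h2, h3, h4, h5⟩ := exists_sphericalHarmonic_eq hm
    refine ⟨_, h1.C_mul ((-1 : ℝ) ^ m.natAbs * √2), hsq _ _ h3, ?_⟩
    ext p
    rw [realSphericalHarmonic, if_neg h.ne', if_pos h, h5, map_mul, eval_C, hre]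

theorem norm_integral_complex_le (U V : MvPolynomial (Fin 3) ℝ) :
    ‖∫ p : UnitSphere2, ((sphereEval p U : ℂ) + (sphereEval p V : ℂ) * Complex.I)
      ∂sphereMeasure‖ ≤ |sphereIntegral U| + |sphereIntegral V| := by
  have hint : ∀ W : MvPolynomial (Fin 3) ℝ,
      Integrable (fun p : UnitSphere2 => (sphereEval p W : ℂ)) sphereMeasure := fun W =>
    (integrable_sphere (continuous_sphereEval W)).ofReal
  rw [integral_add (hint U) ((hint V).mul_const _), integral_mul_const]
  refine (norm_add_le _ _).trans (le_of_eq ?_)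
  rw [norm_mul, Complex.norm_I, mul_one]
  have h : ∀ W : MvPolynomial (Fin 3) ℝ,
      ‖∫ p : UnitSphere2, (sphereEval p W : ℂ) ∂sphereMeasure‖ = |sphereIntegral W| := fun W => by
    have : ∫ p : UnitSphere2, (sphereEval p W : ℂ) ∂sphereMeasure = ((sphereIntegral W : ℝ) : ℂ) :=
      integral_ofReal
    rw [this, Complex.norm_real, Real.norm_eq_abs]
  rw [h, h]

end Harmonics

/-! ### The bound for the structure constants. -/

theorem mainTheorem6 :
    ∃ C : ℝ, 0 < C ∧
      ∀ (ℓ ℓ' L : ℕ) (m m' M : ℤ),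
        1 ≤ ℓ → 1 ≤ ℓ' → 1 ≤ L →
        |m| ≤ (ℓ : ℤ) → |m'| ≤ (ℓ' : ℤ) → |M| ≤ (L : ℤ) →
        ℓ ≤ ℓ' + L → ℓ' ≤ ℓ + L → L ≤ ℓ + ℓ' →
        ‖poissonStructureConstant sphericalHarmonic ℓ m ℓ' m' L M‖
            ≤ C * min ((ℓ : ℝ) * ℓ') (min ((ℓ : ℝ) * L) ((ℓ' : ℝ) * L)) ∧
        |poissonStructureConstant realSphericalHarmonic ℓ m ℓ' m' L M|
            ≤ C * min ((ℓ : ℝ) * ℓ') (min ((ℓ : ℝ) * L) ((ℓ' : ℝ) * L)) := by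
  -- The complex constant splits into eight real trilinear integrals, four in each of the real and
  -- imaginary parts, and each is at most 54 times the minimum: 8 · 54 = 432.
  refine ⟨432, by norm_num, ?_⟩
  intro ℓ ℓ' L m m' M h1 h2 h3 hm hm' hM t1 t2 t3
  have hmin : 0 ≤ min ((ℓ : ℝ) * ℓ') (min ((ℓ : ℝ) * L) ((ℓ' : ℝ) * L)) := by positivity
  constructor
  · obtain ⟨F, F', f1, f2, f3, f4, f5⟩ := exists_sphericalHarmonic_eq hm
    obtain ⟨G, G', g1, g2, g3, g4, g5⟩ := exists_sphericalHarmonic_eq hm'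
    obtain ⟨H, H', e1, e2, e3, e4, e5⟩ := exists_sphericalHarmonic_eq hM
    have key : ∀ {F G H : MvPolynomial (Fin 3) ℝ}, IsSphericalEigen ℓ F → IsSphericalEigen ℓ' G →
        IsSphericalEigen L H → sphereIntegral (F ^ 2) ≤ 1 → sphereIntegral (G ^ 2) ≤ 1 →
        sphereIntegral (H ^ 2) ≤ 1 → |sphereIntegral (polyBracket F G * H)| ≤
          54 * min ((ℓ : ℝ) * ℓ') (min ((ℓ : ℝ) * L) ((ℓ' : ℝ) * L)) :=
      fun hF hG hH a b c => abs_sphereIntegral_polyBracket_mul_le hF hG hH (by linarith)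
        (by linarith) (by linarith) h1 h2 h3 t1 t2 t3
    -- U and V are the real and imaginary parts of {F + iF', G + iG'} · (H - iH').
    set U := polyBracket F G * H - polyBracket F' G' * H + polyBracket F G' * H' +
      polyBracket F' G * H' with hU
    set V := polyBracket F G' * H + polyBracket F' G * H - polyBracket F G * H' +
      polyBracket F' G' * H' with hV
    have e : poissonStructureConstant sphericalHarmonic ℓ m ℓ' m' L M =
        ∫ p : UnitSphere2, ((sphereEval p U : ℂ) + (sphereEval p V : ℂ) * Complex.I)
          ∂sphereMeasure := by
      rw [poissonStructureConstant, f5, g5, e5]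
      congr 1
      ext p
      rw [spherePoisson_complex]
      simp only [hU, hV, map_add, map_sub, map_mul, Complex.conj_ofReal, Complex.conj_I]
      push_cast
      linear_combination (-(sphereEval p (polyBracket F G') + sphereEval p (polyBracket F' G) : ℂ) *
        (sphereEval p H' : ℂ)) * Complex.I_sq
    rw [e]
    refine (norm_integral_complex_le U V).trans ?_
    have k1 := abs_le.mp (key f1 g1 e1 f3 g3 e3)
    have k2 := abs_le.mp (key f2 g2 e1 f4 g4 e3)
    have k3 := abs_le.mp (key f1 g2 e2 f3 g4 e4)
    have k4 := abs_le.mp (key f2 g1 e2 f4 g3 e4)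
    have k5 := abs_le.mp (key f1 g2 e1 f3 g4 e3)
    have k6 := abs_le.mp (key f2 g1 e1 f4 g3 e3)
    have k7 := abs_le.mp (key f1 g1 e2 f3 g3 e4)
    have k8 := abs_le.mp (key f2 g2 e2 f4 g4 e4)
    have hUb : |sphereIntegral U| ≤
        216 * min ((ℓ : ℝ) * ℓ') (min ((ℓ : ℝ) * L) ((ℓ' : ℝ) * L)) := by
      simp only [hU, map_add, map_sub]
      rw [abs_le]
      constructor <;> linarith
    have hVb : |sphereIntegral V| ≤
        216 * min ((ℓ : ℝ) * ℓ') (min ((ℓ : ℝ) * L) ((ℓ' : ℝ) * L)) := by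
      simp only [hV, map_add, map_sub]
      rw [abs_le]
      constructor <;> linarith
    linarith
  · obtain ⟨F, f1, f2, f3⟩ := exists_realSphericalHarmonic_eq hm
    obtain ⟨G, g1, g2, g3⟩ := exists_realSphericalHarmonic_eq hm'
    obtain ⟨H, e1, e2, e3⟩ := exists_realSphericalHarmonic_eq hM
    have e : poissonStructureConstant realSphericalHarmonic ℓ m ℓ' m' L M =
        sphereIntegral (polyBracket F G * H) := by
      rw [poissonStructureConstant, f3, g3, e3, sphereIntegral_apply]
      congr 1
      ext p
      rw [spherePoisson_sphereEval, map_mul]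
      rfl
    rw [e]
    refine (abs_sphereIntegral_polyBracket_mul_le f1 g1 e1 f2 g2 e2 h1 h2 h3 t1 t2 t3).trans ?_
    linarith
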